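/- Let $m,n\ge 1$ be integers. For $1<r<\infty$ and $\mu\in\mathbb R$ let $\dot B^{r,\mu}(\mathbb R^n)$ be the space of all locally $r$-integrable $f:\mathbb R^n\to\mathbb C$ with $$\|f\|_{\dot B^{r,\mu}}=\sup_{R>0}\Bigl(\frac1{|B(0,R)|^{1+\mu r}}\int_{B(0,R)}|f(x)|^r\,dx\Bigr)^{1/r}<\infty,$$ and let $C\dot MO^{r}(\mathbb R^n)$ be the space of all locally $r$-integrable $b:\mathbb R^n\to\mathbb C$ with $$\sup_{R>0}\Bigl(\frac1{|B(0,R)|}\int_{B(0,R)}|b(x)-b_{B(0,R)}|^r\,dx\Bigr)^{1/r}<\infty,\qquad b_{B(0,R)}=\frac1{|B(0,R)|}\int_{B(0,R)}b .$$ Let $\omega$ be a non-negative integrable function on $[0,1]^m$. For $\vec b=(b_1,\dots,b_m)$ and $\vec f=(f_1,\dots,f_m)$ put $$\mathcal H^{\vec b}_\omega(\vec f)(x)=\int_{(0,1)^m}\Bigl(\prod_{i=1}^m f_i(t_ix)\Bigr)\Bigl(\prod_{i=1}^m\bigl(b_i(x)-b_i(t_ix)\bigr)\Bigr)\omega(\vec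 t)\,d\vec t ,\qquad x\in\mathbb R^n .$$ Let $1<p<p_i<\infty$, $1<q_i<\infty$ and $-1/p_i<\lambda_i<0$ for $i=1,\dots,m$, with $$\frac1p=\frac1{p_1}+\cdots+\frac1{p_m}+\frac1{q_1}+\cdots+\frac1{q_m},\qquad \lambda=\lambda_1+\cdots+\lambda_m,$$ and set $$\mathbb C_m=\int_{(0,1)^m}\Bigl(\prod_{i=1}^m t_i^{n\lambda_i}\Bigr)\,\omega(\vec t)\,\prod_{i=1}^m\log\frac2{t_i}\,d\vec t\in[0,\infty].$$ We say that $\mathcal H^{\vec b}_\omega$ is bounded from $\dot B^{p_1,\lambda_1}(\mathbb R^n)\times\cdots\times\dot B^{p_m,\lambda_m}(\mathbb R^n)$ to $\dot B^{p,\lambda}(\mathbb R^n)$ if there is a finite constant $C$ such that, for all $f_i\in\dot B^{p_i,\lambda_i}(\mathbb R^n)$, the integral defining $\mathcal H^{\vec b}_\omega(\vec f)(x)$ converges absolutely for almost every $x$, $\mathcal H^{\vec b}_\omega(\vec f)\in\dot B^{p,\lambda}(\mathbb R^n)$, and $\|\mathcal H^{\vec b}_\omega(\vec f)\|_{\dot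 B^{p,\lambda}}\le C\prod_{i=1}^m\|f_i\|_{\dot B^{p_i,\lambda_i}}$. (i) If $\mathbb C_m<\infty$, then $\mathcal H^{\vec b}_\omega$ is bounded from $\dot B^{p_1,\lambda_1}(\mathbb R^n)\times\cdots\times\dot B^{p_m,\lambda_m}(\mathbb R^n)$ to $\dot B^{p,\lambda}(\mathbb R^n)$ for every $\vec b\in C\dot MO^{q_1}(\mathbb R^n)\times\cdots\times C\dot MO^{q_m}(\mathbb R^n)$. (ii) Assume that $\lambda_1p_1=\cdots=\lambda_mp_m$. If $\mathcal H^{\vec b}_\omega$ is bounded from $\dot B^{p_1,\lambda_1}(\mathbb R^n)\times\cdots\times\dot B^{p_m,\lambda_m}(\mathbb R^n)$ to $\dot B^{p,\lambda}(\mathbb R^n)$ for every $\vec b\in C\dot MO^{q_1}(\mathbb R^n)\times\cdots\times C\dot MO^{q_m}(\mathbb R^n)$, then $\mathbb C_m<\infty$. -/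

import Mathlib

open MeasureTheory Set
open scoped ENNReal NNReal

noncomputable section

/-- The open unit cube `(0,1)^m`, the domain of integration of the operators below. -/
def openUnitCube (m : ℕ) : Set (Fin m → ℝ) :=
  {t | ∀ i, 0 < t i ∧ t i < 1}

/-- Local `p`-integrability on `ℝⁿ`: `p`-integrability on every ball centred at the origin. -/
def LocallyLp {n : ℕ} (p : ℝ) (f : EuclideanSpace ℝ (Fin n) → ℂ) : Prop :=
  ∀ R : ℝ, 0 < R → MemLp f (ENNReal.ofReal p) (volume.restrict (Metric.ball 0 R))

/-- The central Morrey norm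
`sup_{R > 0} ( |B(0,R)|^{-(1 + l p)} ∫_{B(0,R)} |f|^p )^{1/p}`, with values in `[0,∞]`. -/
def centralMorreyNorm {n : ℕ} (p l : ℝ) (f : EuclideanSpace ℝ (Fin n) → ℂ) : ℝ≥0∞ :=
  ⨆ (R : ℝ) (_ : 0 < R),
    ((∫⁻ x in Metric.ball 0 R, ‖f x‖ₑ ^ p) /
      (volume (Metric.ball (0 : EuclideanSpace ℝ (Fin n)) R)) ^ (1 + l * p)) ^ (1 / p)

/-- Membership in the central Morrey space with exponents `p` and `l`. -/
def MemCentralMorrey {n : ℕ} (p l : ℝ) (f : EuclideanSpace ℝ (Fin n) → ℂ) : Prop :=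
  LocallyLp p f ∧ centralMorreyNorm p l f < ∞

/-- The central mean oscillation (semi)norm
`sup_{R > 0} ( |B(0,R)|⁻¹ ∫_{B(0,R)} |b - b_{B(0,R)}|^q )^{1/q}`, with values in `[0,∞]`,
where `b_{B(0,R)}` is the average of `b` over `B(0,R)`. -/
def centralBMONorm {n : ℕ} (q : ℝ) (b : EuclideanSpace ℝ (Fin n) → ℂ) : ℝ≥0∞ :=
  ⨆ (R : ℝ) (_ : 0 < R),
    ((∫⁻ x in Metric.ball 0 R, ‖b x - ⨍ y in Metric.ball 0 R, b y‖ₑ ^ q) /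
      volume (Metric.ball (0 : EuclideanSpace ℝ (Fin n)) R)) ^ (1 / q)

/-- Membership in the central bounded mean oscillation space with exponent `q`. -/
def MemCentralBMO {n : ℕ} (q : ℝ) (b : EuclideanSpace ℝ (Fin n) → ℂ) : Prop :=
  LocallyLp q b ∧ centralBMONorm q b < ∞

/-- The integrand, at the point `x`, of the commutator of the weighted multilinear Hardy operator:
`t ↦ (∏ f_i(t_i x)) (∏ (b_i(x) - b_i(t_i x))) ω(t)`. -/
def hardyCommutatorIntegrand {n m : ℕ} (ω : (Fin m → ℝ) → ℝ)
    (b f : Fin m → EuclideanSpace ℝ (Fin n) → ℂ) (x : EuclideanSpace ℝ (Fin n))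
    (t : Fin m → ℝ) : ℂ :=
  (∏ i, f i (t i • x)) * (∏ i, (b i x - b i (t i • x))) * (ω t : ℂ)

/-- The multilinear commutator of the weighted multilinear Hardy operator. -/
def hardyCommutator {n m : ℕ} (ω : (Fin m → ℝ) → ℝ)
    (b f : Fin m → EuclideanSpace ℝ (Fin n) → ℂ) (x : EuclideanSpace ℝ (Fin n)) : ℂ :=
  ∫ t in openUnitCube m, hardyCommutatorIntegrand ω b f x t

/-- The commutator with symbols `b` is bounded from the product of the central Morrey spaces with
exponents `(ps i, ls i)` to the one with exponents `(p, l)`: on this product the integral defining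
it converges absolutely at almost every point, its values lie in the target space, and the norms
satisfy a multilinear bound with a constant that does not depend on the functions `f`. -/
def HardyCommutatorBounded {n m : ℕ} (ω : (Fin m → ℝ) → ℝ)
    (b : Fin m → EuclideanSpace ℝ (Fin n) → ℂ) (ps ls : Fin m → ℝ) (p l : ℝ) : Prop :=
  ∃ C : ℝ≥0, ∀ f : Fin m → EuclideanSpace ℝ (Fin n) → ℂ,
    (∀ i, MemCentralMorrey (ps i) (ls i) (f i)) →
      (∀ᵐ x, IntegrableOn (hardyCommutatorIntegrand ω b f x) (openUnitCube m)) ∧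
      MemCentralMorrey p l (hardyCommutator ω b f) ∧
      centralMorreyNorm p l (hardyCommutator ω b f) ≤
        C * ∏ i, centralMorreyNorm (ps i) (ls i) (f i)

/-- The constant `∫_{(0,1)^m} (∏ t_i^{n l_i}) ω(t) ∏ log(2 / t_i) dt`, with values in `[0,∞]`. -/
def hardyLogConstant {m : ℕ} (n : ℕ) (ω : (Fin m → ℝ) → ℝ) (ls : Fin m → ℝ) : ℝ≥0∞ :=
  ∫⁻ t in openUnitCube m,
    ENNReal.ofReal ((∏ i, t i ^ ((n : ℝ) * ls i)) * ω t * ∏ i, Real.log (2 / t i))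

end

/-! ### Averages over a finite measure space. -/

section Averages

variable {α : Type*} [MeasurableSpace α] {μ : Measure α}

/-! Sufficiency. Put the `L^p` norm over `B(0,R)` inside the `t`-integral (Minkowski,
`lintegral_lintegral_mul_rpow_le`) and apply Hölder in `x` with the exponents `p_i`, `q_i`. Dilation
turns `f_i(t_i ·)` into a factor `t_i^{nλ_i}`. The increment `b_i - b_i(t_i ·)` costs `log (2 /
t_i)`, because the averages of `b_i` over `B(0,R)` and `B(0,t_i R)` are joined by about `log₂ (1 /
t_i)` balls of comparable size (`eLpNorm'_ball_sub_comp_smul_le`). What remains is the integral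
`ℂ_m`.

Necessity. Testing on `f_i = ‖x‖^{nλ_i}` and `b_i = log ‖x‖` yields only the weight `∏ log (1 /
t_i)`, which degenerates as some `t_i → 1`. The missing constant in `log (2 / t) = log 2 + log (1 /
t)` comes from the bounded symbols `β (log ‖x‖)`. With `s = log ‖x‖` and `h = -log t_j`, boundedness
for each `β` bounds the integrals of `Φ (β(s) - β(s - h))` over a family of kernels `Φ`.
Banach–Steinhaus makes this uniform over `‖β‖ ≤ 1`. Taking `β(u) = e^{iNu}` against `e^{-iNs} Φ`
bounds `∫ Φ (1 - e^{-iNh})` uniformly in `N`. The Cesàro means of `e^{-iNh}` tend to `0` off a null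
set, so `∫ Φ` is bounded too (`exists_forall_norm_integral_le_of_increments`). Hence the `j`-th
increment may be replaced by `1`, and then by `log (2 / t_j)`. Doing this in each coordinate turns
all the increments into logarithms (`hasBoundedPairings_log_two_div`).

The powers are truncated near the origin to make every kernel integrable; the bounds do not depend
on the truncation, and Fatou's lemma removes it at the end. -/

theorem eLpNorm'_sub_le {q : ℝ} (hq : 1 ≤ q) {f g : α → ℂ} (hf : AEStronglyMeasurable f μ)
    (hg : AEStronglyMeasurable g μ) :
    eLpNorm' (f - g) q μ ≤ eLpNorm' f q μ + eLpNorm' g q μ := by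
  have h := eLpNorm'_add_le hf hg.neg hq
  rwa [eLpNorm'_neg, ← sub_eq_add_neg] at h

theorem enorm_average_sub_const_le [IsFiniteMeasure μ] (hμ : μ ≠ 0) {q : ℝ} (hq : 1 ≤ q)
    {b : α → ℂ} (hb : Integrable b μ) (c : ℂ) :
    ‖(⨍ y, b y ∂μ) - c‖ₑ ≤ eLpNorm' (fun y => b y - c) q μ * μ univ ^ (-(1 / q)) := by
  have h0 : μ univ ≠ 0 := by simpa using hμ
  have ht : μ univ ≠ ∞ := measure_ne_top _ _
  have : NeZero μ := ⟨hμ⟩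
  have h1 : (⨍ y, b y ∂μ) - c = ⨍ y, (b y - c) ∂μ := by
    have : ∫ y, (b y - c) ∂μ = ∫ y, b y ∂μ - ∫ _, c ∂μ := integral_sub hb (integrable_const c)
    rw [average_eq, average_eq, this, smul_sub]
    congr 1
    rw [← average_eq, average_const]
  have h2 : ‖⨍ y, (b y - c) ∂μ‖ₑ ≤ (μ univ)⁻¹ * ∫⁻ y, ‖b y - c‖ₑ ∂μ := by
    rw [average_eq, enorm_smul]
    gcongr
    · rw [Real.enorm_eq_ofReal (by positivity), ENNReal.ofReal_inv_of_pos]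
      · simp [Measure.real, ENNReal.ofReal_toReal ht]
      · exact ENNReal.toReal_pos h0 ht
    · exact enorm_integral_le_lintegral_enorm _
  have h3 := eLpNorm'_le_eLpNorm'_mul_rpow_measure_univ (μ := μ) (p := 1) (q := q) one_pos hq
    (f := fun y => b y - c) (hb.aestronglyMeasurable.sub aestronglyMeasurable_const)
  rw [eLpNorm'] at h3
  simp only [ENNReal.rpow_one, div_one] at h3
  rw [h1]
  calc _ ≤ _ := h2
    _ ≤ (μ univ)⁻¹ * (eLpNorm' (fun y => b y - c) q μ * μ univ ^ (1 - 1 / q)) := by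
      gcongr
    _ = eLpNorm' (fun y => b y - c) q μ * ((μ univ) ^ (-1 : ℝ) * μ univ ^ (1 - 1 / q)) := by
      rw [ENNReal.rpow_neg_one]; ring
    _ = _ := by rw [← ENNReal.rpow_add _ _ h0 ht]; congr 2; ring

end Averages

/-! ### Dilations, Morrey bounds and mean oscillation on centred balls. -/

section Balls

variable {n : ℕ}

local notation "E" => EuclideanSpace ℝ (Fin n)

theorem volume_ball_pos_ne_zero {R : ℝ} (hR : 0 < R) :
    volume (Metric.ball (0 : E) R) ≠ 0 :=
  (Metric.measure_ball_pos _ _ hR).ne'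

theorem volume_ball_ne_top (R : ℝ) : volume (Metric.ball (0 : E) R) ≠ ∞ :=
  measure_ball_lt_top.ne

theorem volume_ball_smul {t : ℝ} (ht : 0 < t) (R : ℝ) :
    volume (Metric.ball (0 : E) (t * R)) =
      ENNReal.ofReal (t ^ n) * volume (Metric.ball (0 : E) R) := by
  rw [Measure.addHaar_ball_mul_of_pos volume (0 : E) ht R, finrank_euclideanSpace_fin]

theorem setLIntegral_ball_comp_smul {t : ℝ} (ht : 0 < t) (R : ℝ) (G : E → ℝ≥0∞) :
    ∫⁻ x in Metric.ball 0 R, G (t • x) =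
      (ENNReal.ofReal (t ^ n))⁻¹ * ∫⁻ x in Metric.ball 0 (t * R), G x := by
  have hemb : MeasurableEmbedding (fun x : E => t • x) :=
    (Homeomorph.smulOfNeZero t ht.ne').measurableEmbedding
  have hpre : Metric.ball (0 : E) R = (fun x : E => t • x) ⁻¹' Metric.ball 0 (t * R) := by
    ext x
    simp [norm_smul, abs_of_pos ht, ht]
  rw [hpre, ← hemb.lintegral_map, ← hemb.restrict_map, Measure.map_addHaar_smul _ ht.ne',
    Measure.restrict_smul, lintegral_smul_measure, finrank_euclideanSpace_fin,
    abs_of_pos (by positivity), ENNReal.ofReal_inv_of_pos (by positivity)]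
  rfl

theorem eLpNorm'_ball_comp_smul {t p : ℝ} (ht : 0 < t) (hp : 0 < p) (R : ℝ) (f : E → ℂ) :
    eLpNorm' (fun x => f (t • x)) p (volume.restrict (Metric.ball 0 R)) =
      ENNReal.ofReal (t ^ n) ^ (-(1 / p)) *
        eLpNorm' f p (volume.restrict (Metric.ball 0 (t * R))) := by
  rw [eLpNorm', setLIntegral_ball_comp_smul ht R (fun x => ‖f x‖ₑ ^ p),
    ENNReal.mul_rpow_of_nonneg _ _ (by positivity), eLpNorm', ENNReal.rpow_neg, ENNReal.inv_rpow]

theorem eLpNorm'_ball_le_centralMorreyNorm {p l R : ℝ} (hp : 0 < p) (hR : 0 < R) (f : E → ℂ) :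
    eLpNorm' f p (volume.restrict (Metric.ball 0 R)) ≤
      volume (Metric.ball (0 : E) R) ^ (1 / p + l) * centralMorreyNorm p l f := by
  have hV0 := volume_ball_pos_ne_zero (n := n) hR
  have hVt := volume_ball_ne_top (n := n) R
  have h := le_iSup₂ (f := fun (R : ℝ) (_ : 0 < R) =>
    ((∫⁻ x in Metric.ball 0 R, ‖f x‖ₑ ^ p) /
      (volume (Metric.ball (0 : E) R)) ^ (1 + l * p)) ^ (1 / p)) R hR
  rw [← centralMorreyNorm, ENNReal.div_rpow_of_nonneg _ _ (by positivity), ← ENNReal.rpow_mul,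
    show (1 + l * p) * (1 / p) = 1 / p + l by field_simp] at h
  rw [eLpNorm', mul_comm]
  rwa [← ENNReal.div_le_iff (by simp [ENNReal.rpow_eq_zero_iff, hV0, hVt])
    (by simp [ENNReal.rpow_eq_top_iff, hV0, hVt])]

theorem centralMorreyNorm_le_of_eLpNorm' {p l : ℝ} (hp : 0 < p) (f : E → ℂ) (C : ℝ≥0∞)
    (h : ∀ R, 0 < R → eLpNorm' f p (volume.restrict (Metric.ball 0 R)) ≤
      volume (Metric.ball (0 : E) R) ^ (1 / p + l) * C) :
    centralMorreyNorm p l f ≤ C := by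
  refine iSup₂_le fun R hR => ?_
  have hV0 := volume_ball_pos_ne_zero (n := n) hR
  have hVt := volume_ball_ne_top (n := n) R
  rw [ENNReal.div_rpow_of_nonneg _ _ (by positivity), ← ENNReal.rpow_mul,
    show (1 + l * p) * (1 / p) = 1 / p + l by field_simp,
    ENNReal.div_le_iff (by simp [ENNReal.rpow_eq_zero_iff, hV0, hVt])
    (by simp [ENNReal.rpow_eq_top_iff, hV0, hVt]), mul_comm]
  exact h R hR

theorem eLpNorm'_ball_le_centralBMONorm {q R : ℝ} (hq : 0 < q) (hR : 0 < R) (b : E → ℂ) :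
    eLpNorm' (fun x => b x - ⨍ y in Metric.ball 0 R, b y) q (volume.restrict (Metric.ball 0 R)) ≤
      volume (Metric.ball (0 : E) R) ^ (1 / q) * centralBMONorm q b := by
  have hV0 := volume_ball_pos_ne_zero (n := n) hR
  have hVt := volume_ball_ne_top (n := n) R
  have h := le_iSup₂ (f := fun (R : ℝ) (_ : 0 < R) =>
    ((∫⁻ x in Metric.ball 0 R, ‖b x - ⨍ y in Metric.ball 0 R, b y‖ₑ ^ q) /
      volume (Metric.ball (0 : E) R)) ^ (1 / q)) R hR
  rw [← centralBMONorm, ENNReal.div_rpow_of_nonneg _ _ (by positivity)] at h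
  rw [eLpNorm', mul_comm]
  rwa [← ENNReal.div_le_iff (by simp [ENNReal.rpow_eq_zero_iff, hV0, hVt])
    (by simp [ENNReal.rpow_eq_top_iff, hV0, hVt])]

theorem eLpNorm'_ball_smul_le_centralMorreyNorm {p l t R : ℝ} (hp : 0 < p) (ht : 0 < t)
    (hR : 0 < R) (f : E → ℂ) :
    eLpNorm' (fun x => f (t • x)) p (volume.restrict (Metric.ball 0 R)) ≤
      ENNReal.ofReal (t ^ (n * l)) *
        (volume (Metric.ball (0 : E) R) ^ (1 / p + l) * centralMorreyNorm p l f) := by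
  have hV0 := volume_ball_pos_ne_zero (n := n) hR
  have hVt := volume_ball_ne_top (n := n) R
  have hτ0 : ENNReal.ofReal (t ^ n) ≠ 0 := by simp; positivity
  rw [eLpNorm'_ball_comp_smul ht hp]
  calc _ ≤ ENNReal.ofReal (t ^ n) ^ (-(1 / p)) *
        (volume (Metric.ball (0 : E) (t * R)) ^ (1 / p + l) * centralMorreyNorm p l f) := by
        gcongr
        exact eLpNorm'_ball_le_centralMorreyNorm hp (by positivity) f
    _ = (ENNReal.ofReal (t ^ n) ^ (-(1 / p)) * ENNReal.ofReal (t ^ n) ^ (1 / p + l)) *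
        (volume (Metric.ball (0 : E) R) ^ (1 / p + l) * centralMorreyNorm p l f) := by
        rw [volume_ball_smul ht, ENNReal.mul_rpow_of_ne_top ENNReal.ofReal_ne_top hVt]
        ring
    _ = _ := by
        rw [← ENNReal.rpow_add _ _ hτ0 ENNReal.ofReal_ne_top, neg_add_cancel_left,
          ENNReal.ofReal_rpow_of_pos (by positivity), Real.rpow_mul ht.le, Real.rpow_natCast]

theorem LocallyLp.aestronglyMeasurable {p : ℝ} {f : E → ℂ} (hf : LocallyLp p f) :
    AEStronglyMeasurable f volume := by
  have h : (⋃ k : ℕ, Metric.ball (0 : E) ((k : ℝ) + 1)) = univ := by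
    refine eq_univ_of_forall fun x => mem_iUnion.2 ?_
    obtain ⟨k, hk⟩ := exists_nat_ge ‖x‖
    exact ⟨k, by simpa using hk.trans_lt (lt_add_one _)⟩
  rw [← Measure.restrict_univ (μ := (volume : Measure E)), ← h, aestronglyMeasurable_iUnion_iff]
  exact fun k => (hf _ (by positivity)).aestronglyMeasurable

theorem LocallyLp.integrableOn_ball {p : ℝ} (hp : 1 ≤ p) {f : E → ℂ} (hf : LocallyLp p f)
    {R : ℝ} (hR : 0 < R) : IntegrableOn f (Metric.ball 0 R) := by
  have : IsFiniteMeasure ((volume : Measure E).restrict (Metric.ball 0 R)) :=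
    ⟨by simpa using measure_ball_lt_top⟩
  exact (hf R hR).integrable (by simpa using hp)

/-- The smaller ball has at least `2^{-n}` of the volume of the larger one, so the oscillation over
the larger ball controls the change of average. Bounding `(2^n)^{1/q}` by `2^n` keeps `q` out of the
constant. -/
theorem enorm_average_ball_sub_average_ball_le {q s R : ℝ} (hq : 1 ≤ q) (hs : 1 / 2 ≤ s)
    (hs1 : s ≤ 1) (hR : 0 < R) {b : E → ℂ} (hb : LocallyLp q b) :
    ‖(⨍ y in Metric.ball 0 (s * R), b y) - ⨍ y in Metric.ball 0 R, b y‖ₑ ≤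
      2 ^ n * centralBMONorm q b := by
  have hs0 : 0 < s := by linarith
  have hV0 := volume_ball_pos_ne_zero (n := n) hR
  have hVt := volume_ball_ne_top (n := n) R
  have hW0 := volume_ball_pos_ne_zero (n := n) (mul_pos hs0 hR)
  have hWt := volume_ball_ne_top (n := n) (s * R)
  have : IsFiniteMeasure ((volume : Measure E).restrict (Metric.ball 0 (s * R))) :=
    ⟨by simpa using measure_ball_lt_top⟩
  have h1 := enorm_average_sub_const_le (μ := (volume : Measure E).restrict
    (Metric.ball 0 (s * R))) (by simpa [Measure.restrict_eq_zero] using hW0) hq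
    (hb.integrableOn_ball hq (mul_pos hs0 hR)) (⨍ y in Metric.ball 0 R, b y)
  have hsub : Metric.ball (0 : E) (s * R) ⊆ Metric.ball 0 R :=
    Metric.ball_subset_ball (by nlinarith)
  have h2 : eLpNorm' (fun x => b x - ⨍ y in Metric.ball 0 R, b y) q
      (volume.restrict (Metric.ball 0 (s * R))) ≤
      volume (Metric.ball (0 : E) R) ^ (1 / q) * centralBMONorm q b :=
    (eLpNorm'_mono_measure _ (Measure.restrict_mono hsub le_rfl) (by linarith)).trans
      (eLpNorm'_ball_le_centralBMONorm (by linarith) hR b)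
  have h3 : volume (Metric.ball (0 : E) R) ≤ 2 ^ n * volume (Metric.ball (0 : E) (s * R)) := by
    rw [volume_ball_smul hs0, ← mul_assoc]
    refine le_mul_of_one_le_left (zero_le) ?_
    rw [show (2 : ℝ≥0∞) ^ n = ENNReal.ofReal (2 ^ n) by simp [ENNReal.ofReal_pow],
      ← ENNReal.ofReal_mul (by positivity), ← mul_pow, ENNReal.one_le_ofReal]
    exact one_le_pow₀ (by linarith)
  have hq' : 0 ≤ 1 / q := by positivity
  have h4 : volume (Metric.ball (0 : E) R) ^ (1 / q) ≤
      2 ^ n * volume (Metric.ball (0 : E) (s * R)) ^ (1 / q) := by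
    refine (ENNReal.rpow_le_rpow h3 hq').trans ?_
    rw [ENNReal.mul_rpow_of_nonneg _ _ hq']
    gcongr
    conv_rhs => rw [← ENNReal.rpow_one (2 ^ n)]
    refine ENNReal.rpow_le_rpow_of_exponent_le (one_le_pow₀ (by norm_num)) ?_
    rw [div_le_one (by linarith)]; exact hq
  simp only [Measure.restrict_apply_univ] at h1
  calc _ ≤ _ := h1
    _ ≤ (2 ^ n * volume (Metric.ball (0 : E) (s * R)) ^ (1 / q) * centralBMONorm q b) *
        volume (Metric.ball (0 : E) (s * R)) ^ (-(1 / q)) := by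
        gcongr
        exact h2.trans (by gcongr)
    _ = 2 ^ n * centralBMONorm q b * (volume (Metric.ball (0 : E) (s * R)) ^ (1 / q) *
        volume (Metric.ball (0 : E) (s * R)) ^ (-(1 / q))) := by ring
    _ = _ := by
        rw [← ENNReal.rpow_add _ _ hW0 hWt]; simp

theorem enorm_average_ball_pow_sub_average_ball_le {q s R : ℝ} (hq : 1 ≤ q) (hs : 1 / 2 ≤ s)
    (hs1 : s ≤ 1) (hR : 0 < R) {b : E → ℂ} (hb : LocallyLp q b) (k : ℕ) :
    ‖(⨍ y in Metric.ball 0 (s ^ k * R), b y) - ⨍ y in Metric.ball 0 R, b y‖ₑ ≤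
      k * (2 ^ n * centralBMONorm q b) := by
  have hs0 : 0 < s := by linarith
  induction k with
  | zero => simp
  | succ k ih =>
    have h1 := enorm_average_ball_sub_average_ball_le hq hs hs1 (R := s ^ k * R)
      (by positivity) hb
    rw [← mul_assoc, ← pow_succ'] at h1
    rw [← sub_add_sub_cancel _ (⨍ y in Metric.ball 0 (s ^ k * R), b y)]
    refine (enorm_add_le _ _).trans ((add_le_add h1 ih).trans_eq ?_)
    push_cast
    ring

theorem enorm_average_ball_smul_sub_average_ball_le {q t R : ℝ} (hq : 1 ≤ q) (ht : 0 < t)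
    (ht1 : t < 1) (hR : 0 < R) {b : E → ℂ} (hb : LocallyLp q b) :
    ‖(⨍ y in Metric.ball 0 (t * R), b y) - ⨍ y in Metric.ball 0 R, b y‖ₑ ≤
      ENNReal.ofReal (Real.log (2 / t) / Real.log 2) * (2 ^ n * centralBMONorm q b) := by
  have hl2 : 0 < Real.log 2 := Real.log_pos (by norm_num)
  have hlt : Real.log t < 0 := Real.log_neg ht ht1
  -- The passage from `R` to `t R` takes `k` equal steps of ratio `t^{1/k} ≥ 1/2`. Rounding up costs
  -- at most one step, and `-log t / log 2 + 1 = log (2 / t) / log 2`; this is the source of the `2`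
  -- in the logarithm.
  set k := ⌈-Real.log t / Real.log 2⌉₊ with hk
  have hk0 : 0 < k := Nat.ceil_pos.2 (div_pos (by linarith) hl2)
  have hk1 : -Real.log t / Real.log 2 ≤ k := Nat.le_ceil _
  have hk2 : (k : ℝ) < -Real.log t / Real.log 2 + 1 :=
    Nat.ceil_lt_add_one (div_nonneg (by linarith) hl2.le)
  have hkR : (0 : ℝ) < k := by exact_mod_cast hk0
  have hs : 1 / 2 ≤ t ^ ((k : ℝ)⁻¹) := by
    rw [one_div, ← Real.log_le_log_iff (by norm_num) (by positivity), Real.log_inv,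
      Real.log_rpow ht]
    rw [div_le_iff₀ hl2] at hk1
    rw [← mul_le_mul_iff_of_pos_left hkR, mul_inv_cancel_left₀ hkR.ne']
    linarith
  have h := enorm_average_ball_pow_sub_average_ball_le hq hs
    (Real.rpow_le_one ht.le ht1.le (by positivity)) hR hb k
  rw [Real.rpow_inv_natCast_pow ht.le hk0.ne'] at h
  refine h.trans ?_
  gcongr
  rw [← ENNReal.ofReal_natCast]
  refine ENNReal.ofReal_le_ofReal (hk2.le.trans_eq ?_)
  rw [Real.log_div (by norm_num) ht.ne']
  field_simp
  ring

/-- Subtract from `b` its average over `B(0,R)`, and from `b(t ·)` the average of `b` over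
`B(0,tR)`. Both remainders are plain oscillations, and only the difference of the two averages grows
with `1 / t`. -/
theorem eLpNorm'_ball_sub_comp_smul_le {q t R : ℝ} (hq : 1 ≤ q) (ht : 0 < t)
    (ht1 : t < 1) (hR : 0 < R) {b : E → ℂ} (hb : LocallyLp q b) :
    eLpNorm' (fun x => b x - b (t • x)) q (volume.restrict (Metric.ball 0 R)) ≤
      ENNReal.ofReal (Real.log (2 / t)) * (volume (Metric.ball (0 : E) R) ^ (1 / q) *
        (ENNReal.ofReal (1 / Real.log 2) * (2 + 2 ^ n) * centralBMONorm q b)) := by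
  have hq0 : 0 < q := by linarith
  have hl2 : 0 < Real.log 2 := Real.log_pos (by norm_num)
  have hV0 := volume_ball_pos_ne_zero (n := n) hR
  have hVt := volume_ball_ne_top (n := n) R
  have hτ0 : ENNReal.ofReal (t ^ n) ≠ 0 := by simp; positivity
  set V := volume (Metric.ball (0 : E) R)
  set N := centralBMONorm q b
  set c := ⨍ y in Metric.ball 0 R, b y
  set d := ⨍ y in Metric.ball 0 (t * R), b y
  have hmeas := hb.aestronglyMeasurable
  have hmeas' : AEStronglyMeasurable (fun x => b (t • x)) volume := by
    refine hmeas.comp_quasiMeasurePreserving ⟨measurable_const_smul t, ?_⟩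
    rw [Measure.map_addHaar_smul _ ht.ne']
    exact Measure.smul_absolutelyContinuous
  have h1 : eLpNorm' (fun x => b x - c) q (volume.restrict (Metric.ball 0 R)) ≤ V ^ (1 / q) * N :=
    eLpNorm'_ball_le_centralBMONorm hq0 hR b
  have h2 : eLpNorm' (fun x => b (t • x) - d) q (volume.restrict (Metric.ball 0 R)) ≤
      V ^ (1 / q) * N := by
    rw [eLpNorm'_ball_comp_smul ht hq0 R (fun x => b x - d)]
    refine (mul_le_mul_right (eLpNorm'_ball_le_centralBMONorm hq0 (by positivity) b) _).trans_eq ?_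
    rw [volume_ball_smul ht, ENNReal.mul_rpow_of_ne_top ENNReal.ofReal_ne_top hVt, ← mul_assoc,
      ← mul_assoc, ← ENNReal.rpow_add _ _ hτ0 ENNReal.ofReal_ne_top]
    simp [V, N]
  have h3 : eLpNorm' (fun _ : E => d - c) q (volume.restrict (Metric.ball 0 R)) ≤
      ENNReal.ofReal (Real.log (2 / t) / Real.log 2) * (2 ^ n * N) * V ^ (1 / q) := by
    rw [eLpNorm'_const _ hq0, Measure.restrict_apply_univ]
    gcongr
    exact enorm_average_ball_smul_sub_average_ball_le hq ht ht1 hR hb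
  -- This lets the two oscillation terms, which do not depend on `t`, be absorbed into the
  -- logarithm.
  have hL : 1 ≤ ENNReal.ofReal (Real.log (2 / t) / Real.log 2) := by
    rw [ENNReal.one_le_ofReal, one_le_div hl2]
    refine Real.log_le_log (by norm_num) ?_
    rw [le_div_iff₀ ht]; linarith
  have hsplit : (fun x => b x - b (t • x)) =
      ((fun x => b x - c) - fun x => (b (t • x) - d)) - fun _ => d - c := by
    ext x
    simp only [Pi.sub_apply]
    ring
  have hm1 : AEStronglyMeasurable (fun x => b x - c) (volume.restrict (Metric.ball (0 : E) R)) :=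
    (hmeas.sub aestronglyMeasurable_const).restrict
  have hm2 : AEStronglyMeasurable (fun x => b (t • x) - d)
      (volume.restrict (Metric.ball (0 : E) R)) :=
    (hmeas'.sub aestronglyMeasurable_const).restrict
  rw [hsplit]
  calc _ ≤ (V ^ (1 / q) * N + V ^ (1 / q) * N) +
        ENNReal.ofReal (Real.log (2 / t) / Real.log 2) * (2 ^ n * N) * V ^ (1 / q) := by
        refine (eLpNorm'_sub_le hq (hm1.sub hm2) aestronglyMeasurable_const).trans
          (add_le_add ?_ h3)
        exact (eLpNorm'_sub_le hq hm1 hm2).trans (add_le_add h1 h2)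
    _ ≤ ENNReal.ofReal (Real.log (2 / t) / Real.log 2) * (V ^ (1 / q) * N + V ^ (1 / q) * N) +
        ENNReal.ofReal (Real.log (2 / t) / Real.log 2) * (2 ^ n * N) * V ^ (1 / q) := by
        gcongr
        exact le_mul_of_one_le_left (zero_le) hL
    _ = _ := by
        rw [div_eq_mul_one_div, ENNReal.ofReal_mul' (by positivity)]
        ring

end Balls

/-! ### Minkowski's and Hölder's inequalities for `ℝ≥0∞`-valued functions. -/

section Inequalities

theorem Complex.enorm_prod {ι : Type*} (s : Finset ι) (g : ι → ℂ) :
    ‖∏ i ∈ s, g i‖ₑ = ∏ i ∈ s, ‖g i‖ₑ :=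
  map_prod (⟨⟨fun z : ℂ => ‖z‖ₑ, by simp⟩, fun a b => enorm_mul a b⟩ : ℂ →* ℝ≥0∞) _ _

/-- Minkowski's integral inequality for slices with a common `L^p` bound `A`: Hölder against the
measure `v dν` moves the power `p` inside, and Tonelli then exchanges the integrals. -/
theorem lintegral_lintegral_mul_rpow_le {α β : Type*} [MeasurableSpace α] [MeasurableSpace β]
    {μ : Measure α} {ν : Measure β} [SFinite μ] [SFinite ν] {p : ℝ} (hp : 1 < p)
    {h : α → β → ℝ≥0∞} (hh : AEMeasurable (Function.uncurry h) (μ.prod ν))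
    {v : β → ℝ≥0∞} (hv : AEMeasurable v ν) (A : ℝ≥0∞)
    (hA : ∀ᵐ t ∂ν, ∫⁻ x, h x t ^ p ∂μ ≤ A ^ p) :
    ∫⁻ x, (∫⁻ t, h x t * v t ∂ν) ^ p ∂μ ≤ (A * ∫⁻ t, v t ∂ν) ^ p := by
  have hp0 : 0 < p := by linarith
  set q := p.conjExponent
  have hpq : p.HolderConjugate q := Real.HolderConjugate.conjExponent hp
  have hq0 : 0 < q := hpq.symm.pos
  set K := ∫⁻ t, v t ∂ν
  have hint : AEMeasurable (Function.uncurry fun x t => h x t ^ p * v t) (μ.prod ν) :=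
    (hh.pow_const p).mul hv.comp_snd
  have h1 : ∀ᵐ x ∂μ, (∫⁻ t, h x t * v t ∂ν) ^ p ≤
      (∫⁻ t, h x t ^ p * v t ∂ν) * K ^ (p - 1) := by
    filter_upwards [hh.aestronglyMeasurable.prodMk_left] with x hx'
    have hx : AEMeasurable (h x) ν := hx'.aemeasurable
    have hsplit : ∀ t, h x t * v t = (h x t * v t ^ (1 / p)) * v t ^ (1 / q) := fun t => by
      rw [mul_assoc, ← ENNReal.rpow_add_of_nonneg _ _ (by positivity) (by positivity),
        hpq.one_div_add_one_div, div_one, ENNReal.rpow_one]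
    have hH := ENNReal.lintegral_mul_le_Lp_mul_Lq ν hpq (f := fun t => h x t * v t ^ (1 / p))
      (g := fun t => v t ^ (1 / q)) (hx.mul (hv.pow_const _)) (hv.pow_const _)
    simp only [Pi.mul_apply, ← hsplit] at hH
    have e1 : ∀ t, (h x t * v t ^ (1 / p)) ^ p = h x t ^ p * v t := fun t => by
      rw [ENNReal.mul_rpow_of_nonneg _ _ hp0.le, ← ENNReal.rpow_mul, one_div_mul_cancel hp0.ne',
        ENNReal.rpow_one]
    have e2 : ∀ t, (v t ^ (1 / q)) ^ q = v t := fun t => by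
      rw [← ENNReal.rpow_mul, one_div_mul_cancel hq0.ne', ENNReal.rpow_one]
    simp only [e1, e2] at hH
    refine (ENNReal.rpow_le_rpow hH hp0.le).trans_eq ?_
    rw [ENNReal.mul_rpow_of_nonneg _ _ hp0.le, ← ENNReal.rpow_mul, ← ENNReal.rpow_mul,
      one_div_mul_cancel hp0.ne', ENNReal.rpow_one]
    congr 2
    rw [one_div_mul_eq_div, hpq.div_conj_eq_sub_one]
  calc _ ≤ ∫⁻ x, (∫⁻ t, h x t ^ p * v t ∂ν) * K ^ (p - 1) ∂μ := lintegral_mono_ae h1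
    _ = (∫⁻ x, ∫⁻ t, h x t ^ p * v t ∂ν ∂μ) * K ^ (p - 1) :=
        lintegral_mul_const'' _ hint.lintegral_prod_right'
    _ = (∫⁻ t, ∫⁻ x, h x t ^ p * v t ∂μ ∂ν) * K ^ (p - 1) := by
        rw [lintegral_lintegral_swap hint]
    _ ≤ (∫⁻ t, A ^ p * v t ∂ν) * K ^ (p - 1) := by
        gcongr 1
        refine lintegral_mono_ae ?_
        filter_upwards [hA, hh.aestronglyMeasurable.prodMk_right] with t ht htm
        have htm' : AEMeasurable (fun x => h x t) μ := htm.aemeasurable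
        rw [lintegral_mul_const'' _ (htm'.pow_const p)]
        gcongr
    _ = A ^ p * (K ^ (1 : ℝ) * K ^ (p - 1)) := by
        rw [lintegral_const_mul'' _ hv, ENNReal.rpow_one, mul_assoc]
    _ = _ := by
        rw [← ENNReal.rpow_add_of_nonneg _ _ zero_le_one (by linarith), add_sub_cancel,
          ENNReal.mul_rpow_of_nonneg _ _ hp0.le]

/-- Hölder's inequality for several factors, applied to the functions `F i ^ r i` with the weights
`p / r i`, whose sum is `1`. -/
theorem lintegral_prod_rpow_le_prod_lintegral_rpow {α ι : Type*} [MeasurableSpace α]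
    {μ : Measure α} [Fintype ι] {p : ℝ} (hp : 0 < p) {r : ι → ℝ} (hr : ∀ i, 0 < r i)
    (hpr : 1 / p = ∑ i, 1 / r i) {F : ι → α → ℝ≥0∞} (hF : ∀ i, AEMeasurable (F i) μ) :
    ∫⁻ x, (∏ i, F i x) ^ p ∂μ ≤ (∏ i, (∫⁻ x, F i x ^ r i ∂μ) ^ (1 / r i)) ^ p := by
  have h := ENNReal.lintegral_prod_norm_pow_le (μ := μ) Finset.univ
    (f := fun i x => F i x ^ r i) (fun i _ => (hF i).pow_const _) (p := fun i => p / r i)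
    (by
      simp only [div_eq_mul_one_div p]
      rw [← Finset.mul_sum, ← hpr]; field_simp)
    (fun i _ => (div_pos hp (hr i)).le)
  have e : ∀ i, r i * (p / r i) = p := fun i => by field_simp [(hr i).ne']
  simp only [← ENNReal.rpow_mul, e] at h
  simp only [← ENNReal.prod_rpow_of_nonneg hp.le]
  refine h.trans_eq (Finset.prod_congr rfl fun i _ => ?_)
  rw [← ENNReal.rpow_mul]
  congr 1; ring

end Inequalities

/-! ### Sufficiency: boundedness of the commutator when the constant is finite. -/

section Operator

variable {n m : ℕ}

local notation "E" => EuclideanSpace ℝ (Fin n)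

theorem measurableSet_openUnitCube (m : ℕ) : MeasurableSet (openUnitCube m) := by
  have : openUnitCube m = Set.univ.pi fun _ => Ioo (0 : ℝ) 1 := by
    ext t; simp [openUnitCube]
  rw [this]
  exact MeasurableSet.univ_pi fun _ => measurableSet_Ioo

theorem openUnitCube_subset_Icc (m : ℕ) : openUnitCube m ⊆ Icc 0 1 :=
  fun _ ht => ⟨fun i => (ht i).1.le, fun i => (ht i).2.le⟩

/-- This makes `f (t i • x)` jointly measurable in `(x, t)` when `f` is only almost everywhere
strongly measurable. -/
theorem quasiMeasurePreserving_coordinate_smul (i : Fin m) :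
    Measure.QuasiMeasurePreserving (fun z : E × (Fin m → ℝ) => z.2 i • z.1)
      ((volume : Measure E).prod (volume.restrict (openUnitCube m))) volume := by
  refine QuasiMeasurePreserving.prod_of_left (by fun_prop) ?_
  filter_upwards [ae_restrict_mem (measurableSet_openUnitCube m)] with t ht
  refine ⟨by fun_prop, ?_⟩
  rw [Measure.map_addHaar_smul _ (ht i).1.ne']
  exact Measure.smul_absolutelyContinuous

theorem aestronglyMeasurable_hardyCommutatorIntegrand {ω : (Fin m → ℝ) → ℝ}
    (hω : AEStronglyMeasurable ω (volume.restrict (openUnitCube m)))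
    {b f : Fin m → E → ℂ} (hb : ∀ i, AEStronglyMeasurable (b i) volume)
    (hf : ∀ i, AEStronglyMeasurable (f i) volume) :
    AEStronglyMeasurable (fun z : E × (Fin m → ℝ) => hardyCommutatorIntegrand ω b f z.1 z.2)
      ((volume : Measure E).prod (volume.restrict (openUnitCube m))) := by
  unfold hardyCommutatorIntegrand
  refine AEStronglyMeasurable.mul (AEStronglyMeasurable.mul ?_ ?_) ?_
  · exact Finset.aestronglyMeasurable_fun_prod _ fun i _ =>
      (hf i).comp_quasiMeasurePreserving (quasiMeasurePreserving_coordinate_smul i)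
  · exact Finset.aestronglyMeasurable_fun_prod _ fun i _ => ((hb i).comp_fst).sub
      ((hb i).comp_quasiMeasurePreserving (quasiMeasurePreserving_coordinate_smul i))
  · exact (Complex.continuous_ofReal.comp_aestronglyMeasurable hω).comp_snd

/-- The integrand of `hardyLogConstant` without the factor `ω`. -/
noncomputable def hardyLogWeight {m : ℕ} (n : ℕ) (ls : Fin m → ℝ) (t : Fin m → ℝ) : ℝ≥0∞ :=
  ∏ i, (ENNReal.ofReal (t i ^ ((n : ℝ) * ls i)) * ENNReal.ofReal (Real.log (2 / t i)))

theorem log_two_div_pos {t : ℝ} (ht : 0 < t) (ht1 : t < 1) : 0 < Real.log (2 / t) := by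
  refine Real.log_pos ?_
  rw [lt_div_iff₀ ht]; linarith

theorem hardyLogWeight_ne_zero {ls : Fin m → ℝ} {t : Fin m → ℝ} (ht : t ∈ openUnitCube m) :
    hardyLogWeight n ls t ≠ 0 := by
  refine Finset.prod_ne_zero_iff.2 fun i _ => mul_ne_zero ?_ ?_
  · simpa using Real.rpow_pos_of_pos (ht i).1 _
  · simpa using log_two_div_pos (ht i).1 (ht i).2

theorem hardyLogWeight_ne_top (ls : Fin m → ℝ) (t : Fin m → ℝ) :
    hardyLogWeight n ls t ≠ ∞ :=
  ENNReal.prod_ne_top fun _ _ => ENNReal.mul_ne_top ENNReal.ofReal_ne_top ENNReal.ofReal_ne_top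

theorem measurable_hardyLogWeight (ls : Fin m → ℝ) : Measurable (hardyLogWeight n ls) := by
  unfold hardyLogWeight
  fun_prop

theorem hardyLogConstant_eq {ω : (Fin m → ℝ) → ℝ} (hω : ∀ t ∈ Icc (0 : Fin m → ℝ) 1, 0 ≤ ω t)
    (ls : Fin m → ℝ) : hardyLogConstant n ω ls =
      ∫⁻ t in openUnitCube m, hardyLogWeight n ls t * ‖ω t‖ₑ := by
  refine setLIntegral_congr_fun (measurableSet_openUnitCube m) fun t ht => ?_
  have h0 := hω t (openUnitCube_subset_Icc m ht)
  have h1 : 0 ≤ ∏ i, t i ^ ((n : ℝ) * ls i) :=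
    Finset.prod_nonneg fun i _ => Real.rpow_nonneg (ht i).1.le _
  have h2 : 0 ≤ ∏ i, Real.log (2 / t i) :=
    Finset.prod_nonneg fun i _ => (log_two_div_pos (ht i).1 (ht i).2).le
  rw [hardyLogWeight, Finset.prod_mul_distrib, ENNReal.ofReal_mul (mul_nonneg h1 h0),
    ENNReal.ofReal_mul h1, ENNReal.ofReal_prod_of_nonneg, ENNReal.ofReal_prod_of_nonneg,
    Real.enorm_eq_ofReal h0]
  · ring
  · exact fun i _ => (log_two_div_pos (ht i).1 (ht i).2).le
  · exact fun i _ => Real.rpow_nonneg (ht i).1.le _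

theorem enorm_hardyCommutatorIntegrand (ω : (Fin m → ℝ) → ℝ) (b f : Fin m → E → ℂ) (x : E)
    (t : Fin m → ℝ) : ‖hardyCommutatorIntegrand ω b f x t‖ₑ =
      (∏ i, ‖f i (t i • x)‖ₑ) * (∏ i, ‖b i x - b i (t i • x)‖ₑ) * ‖ω t‖ₑ := by
  rw [hardyCommutatorIntegrand, enorm_mul, enorm_mul, Complex.enorm_prod, Complex.enorm_prod]
  congr 1
  rw [← ofReal_norm, ← ofReal_norm, Complex.norm_real]

variable {p l : ℝ} {ps qs ls : Fin m → ℝ} {b f : Fin m → EuclideanSpace ℝ (Fin n) → ℂ}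

theorem setLIntegral_prod_mul_prod_rpow_le (hp : 1 < p) (hps : ∀ i, p < ps i)
    (hqs : ∀ i, 1 < qs i) (hpsum : 1 / p = ∑ i, 1 / ps i + ∑ i, 1 / qs i)
    (hlsum : l = ∑ i, ls i) (hb : ∀ i, LocallyLp (qs i) (b i))
    (hf : ∀ i, LocallyLp (ps i) (f i)) {R : ℝ} (hR : 0 < R) {t : Fin m → ℝ}
    (ht : t ∈ openUnitCube m) :
    ∫⁻ x in Metric.ball 0 R,
        ((∏ i, ‖f i (t i • x)‖ₑ) * (∏ i, ‖b i x - b i (t i • x)‖ₑ)) ^ p ≤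
      (hardyLogWeight n ls t * (volume (Metric.ball (0 : E) R) ^ (1 / p + l) *
        ((∏ i, ENNReal.ofReal (1 / Real.log 2) * (2 + 2 ^ n) * centralBMONorm (qs i) (b i)) *
          ∏ i, centralMorreyNorm (ps i) (ls i) (f i)))) ^ p := by
  have hV0 := volume_ball_pos_ne_zero (n := n) hR
  have hVt := volume_ball_ne_top (n := n) R
  have hsm : ∀ (i : Fin m) {g : E → ℂ}, AEStronglyMeasurable g volume →
      AEStronglyMeasurable (fun x => g (t i • x)) volume := fun i g hg => by
    refine hg.comp_quasiMeasurePreserving ⟨measurable_const_smul _, ?_⟩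
    rw [Measure.map_addHaar_smul _ (ht i).1.ne']
    exact Measure.smul_absolutelyContinuous
  have h := lintegral_prod_rpow_le_prod_lintegral_rpow
    (μ := (volume : Measure E).restrict (Metric.ball 0 R)) (p := p) (by linarith)
    (r := Sum.elim ps qs) (by
      rintro (i | i)
      · have := hps i; simp only [Sum.elim_inl]; linarith
      · have := hqs i; simp only [Sum.elim_inr]; linarith)
    (by simp [hpsum])
    (F := Sum.elim (fun i x => ‖f i (t i • x)‖ₑ) (fun i x => ‖b i x - b i (t i • x)‖ₑ)) (by
      rintro (i | i)
      · exact (hsm i (hf i).aestronglyMeasurable).restrict.enorm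
      · exact ((hb i).aestronglyMeasurable.sub
          (hsm i (hb i).aestronglyMeasurable)).restrict.enorm)
  simp only [Fintype.prod_sum_type, Sum.elim_inl, Sum.elim_inr] at h
  refine h.trans (ENNReal.rpow_le_rpow ?_ (by linarith))
  -- The exponents `1 / p_i + λ_i` and `1 / q_i` add up to `1 / p + λ`, the scaling of the target
  -- space.
  have hVpow : volume (Metric.ball (0 : E) R) ^ (1 / p + l) =
      (∏ i, volume (Metric.ball (0 : E) R) ^ (1 / ps i + ls i)) *
        ∏ i, volume (Metric.ball (0 : E) R) ^ (1 / qs i) := by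
    have hprod (e : Fin m → ℝ) : ∏ i, volume (Metric.ball (0 : E) R) ^ e i =
        volume (Metric.ball (0 : E) R) ^ ∑ i, e i := by
      induction (Finset.univ : Finset (Fin m)) using Finset.induction_on with
      | empty => simp
      | insert a s ha ih =>
        rw [Finset.prod_insert ha, Finset.sum_insert ha, ih, ENNReal.rpow_add _ _ hV0 hVt]
    rw [hprod, hprod, ← ENNReal.rpow_add _ _ hV0 hVt, Finset.sum_add_distrib, hpsum, hlsum]
    congr 1; ring
  calc _ ≤ (∏ i, ENNReal.ofReal (t i ^ (n * ls i)) *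
        (volume (Metric.ball (0 : E) R) ^ (1 / ps i + ls i) *
          centralMorreyNorm (ps i) (ls i) (f i))) *
      ∏ i, ENNReal.ofReal (Real.log (2 / t i)) *
        (volume (Metric.ball (0 : E) R) ^ (1 / qs i) *
        (ENNReal.ofReal (1 / Real.log 2) * (2 + 2 ^ n) * centralBMONorm (qs i) (b i))) := by
        refine mul_le_mul' (Finset.prod_le_prod' fun i _ => ?_)
          (Finset.prod_le_prod' fun i _ => ?_)
        · exact eLpNorm'_ball_smul_le_centralMorreyNorm (by linarith [hps i]) (ht i).1 hR _
        · exact eLpNorm'_ball_sub_comp_smul_le (hqs i).le (ht i).1 (ht i).2 hR (hb i)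
    _ = _ := by
        rw [hVpow, hardyLogWeight]
        simp only [Finset.prod_mul_distrib]
        ring

theorem setLIntegral_ball_lintegral_hardyCommutatorIntegrand_rpow_le
    {ω : (Fin m → ℝ) → ℝ} (hω_nonneg : ∀ t ∈ Icc (0 : Fin m → ℝ) 1, 0 ≤ ω t)
    (hω : AEStronglyMeasurable ω (volume.restrict (openUnitCube m)))
    (hp : 1 < p) (hps : ∀ i, p < ps i)
    (hqs : ∀ i, 1 < qs i) (hpsum : 1 / p = ∑ i, 1 / ps i + ∑ i, 1 / qs i)
    (hlsum : l = ∑ i, ls i) (hb : ∀ i, LocallyLp (qs i) (b i))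
    (hf : ∀ i, LocallyLp (ps i) (f i)) {R : ℝ} (hR : 0 < R) :
    ∫⁻ x in Metric.ball 0 R,
        (∫⁻ t in openUnitCube m, ‖hardyCommutatorIntegrand ω b f x t‖ₑ) ^ p ≤
      (volume (Metric.ball (0 : E) R) ^ (1 / p + l) *
        ((∏ i, ENNReal.ofReal (1 / Real.log 2) * (2 + 2 ^ n) * centralBMONorm (qs i) (b i)) *
          ∏ i, centralMorreyNorm (ps i) (ls i) (f i)) * hardyLogConstant n ω ls) ^ p := by
  have hp0 : 0 < p := by linarith
  set ν := (volume : Measure (Fin m → ℝ)).restrict (openUnitCube m)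
  set μ := (volume : Measure E).restrict (Metric.ball 0 R)
  have hac : μ.prod ν ≪ (volume : Measure E).prod ν :=
    Measure.absolutelyContinuous_of_le Measure.restrict_le_self |>.prod
      Measure.AbsolutelyContinuous.rfl
  have hgm : AEMeasurable (fun z : E × (Fin m → ℝ) =>
      (∏ i, ‖f i (z.2 i • z.1)‖ₑ) * ∏ i, ‖b i z.1 - b i (z.2 i • z.1)‖ₑ) (μ.prod ν) := by
    refine AEMeasurable.mono_ac (ν := (volume : Measure E).prod ν)
      (AEMeasurable.mul ?_ ?_) hac
    · exact Finset.aemeasurable_fun_prod _ fun i _ =>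
        ((hf i).aestronglyMeasurable.comp_quasiMeasurePreserving
          (quasiMeasurePreserving_coordinate_smul i)).enorm
    · exact Finset.aemeasurable_fun_prod _ fun i _ =>
        (((hb i).aestronglyMeasurable.comp_fst).sub
          ((hb i).aestronglyMeasurable.comp_quasiMeasurePreserving
            (quasiMeasurePreserving_coordinate_smul i))).enorm
  -- Dividing the slice at `t` by `hardyLogWeight` makes its `L^p` bound independent of `t`. The
  -- weight goes into `v`, whose integral is `hardyLogConstant`.
  have key := lintegral_lintegral_mul_rpow_le (μ := μ) (ν := ν) hp
    (h := fun x t => (hardyLogWeight n ls t)⁻¹ *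
      ((∏ i, ‖f i (t i • x)‖ₑ) * ∏ i, ‖b i x - b i (t i • x)‖ₑ))
    (((measurable_hardyLogWeight ls).inv.comp measurable_snd).aemeasurable.mul hgm)
    (v := fun t => hardyLogWeight n ls t * ‖ω t‖ₑ)
    ((measurable_hardyLogWeight ls).aemeasurable.mul hω.enorm)
    (volume (Metric.ball (0 : E) R) ^ (1 / p + l) *
        ((∏ i, ENNReal.ofReal (1 / Real.log 2) * (2 + 2 ^ n) * centralBMONorm (qs i) (b i)) *
          ∏ i, centralMorreyNorm (ps i) (ls i) (f i))) (by
      filter_upwards [ae_restrict_mem (measurableSet_openUnitCube m)] with t ht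
      have hw0 := hardyLogWeight_ne_zero (n := n) (ls := ls) ht
      have hwt := hardyLogWeight_ne_top (n := n) ls t
      simp only [ENNReal.mul_rpow_of_nonneg (hardyLogWeight n ls t)⁻¹ _ hp0.le]
      rw [lintegral_const_mul' _ _ (by simp [ENNReal.rpow_eq_top_iff, hw0, hwt])]
      refine (mul_le_mul_right (setLIntegral_prod_mul_prod_rpow_le hp hps hqs hpsum hlsum hb hf hR
        ht) _).trans_eq ?_
      rw [← ENNReal.mul_rpow_of_nonneg _ _ hp0.le, ← mul_assoc, ENNReal.inv_mul_cancel hw0 hwt,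
        one_mul])
  rw [← hardyLogConstant_eq hω_nonneg] at key
  refine le_trans (le_of_eq ?_) key
  refine lintegral_congr fun x => ?_
  congr 1
  refine setLIntegral_congr_fun (measurableSet_openUnitCube m) fun t ht => ?_
  have hw0 := hardyLogWeight_ne_zero (n := n) (ls := ls) ht
  have hwt := hardyLogWeight_ne_top (n := n) ls t
  simp only [enorm_hardyCommutatorIntegrand]
  calc _ = ((hardyLogWeight n ls t)⁻¹ * hardyLogWeight n ls t) *
      ((∏ i, ‖f i (t i • x)‖ₑ) * (∏ i, ‖b i x - b i (t i • x)‖ₑ) * ‖ω t‖ₑ) := by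
        rw [ENNReal.inv_mul_cancel hw0 hwt, one_mul]
    _ = _ := by ring

theorem hardyCommutatorBounded_of_hardyLogConstant_lt_top
    {ω : (Fin m → ℝ) → ℝ} (hω_nonneg : ∀ t ∈ Icc (0 : Fin m → ℝ) 1, 0 ≤ ω t)
    (hω : AEStronglyMeasurable ω (volume.restrict (openUnitCube m)))
    (hp : 1 < p) (hps : ∀ i, p < ps i)
    (hqs : ∀ i, 1 < qs i) (hpsum : 1 / p = ∑ i, 1 / ps i + ∑ i, 1 / qs i)
    (hlsum : l = ∑ i, ls i) (hK : hardyLogConstant n ω ls < ∞)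
    (hb : ∀ i, MemCentralBMO (qs i) (b i)) :
    HardyCommutatorBounded ω b ps ls p l := by
  have hp0 : 0 < p := by linarith
  set D := ∏ i, ENNReal.ofReal (1 / Real.log 2) * (2 + 2 ^ n) * centralBMONorm (qs i) (b i)
    with hD
  have hDt : D ≠ ∞ := ENNReal.prod_ne_top fun i _ =>
    ENNReal.mul_ne_top (ENNReal.mul_ne_top ENNReal.ofReal_ne_top (by finiteness)) (hb i).2.ne
  refine ⟨(D * hardyLogConstant n ω ls).toNNReal, fun f hf => ?_⟩
  set M := ∏ i, centralMorreyNorm (ps i) (ls i) (f i)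
  have hMt : M ≠ ∞ := ENNReal.prod_ne_top fun i _ => (hf i).2.ne
  have hmeas := aestronglyMeasurable_hardyCommutatorIntegrand hω
    (fun i => (hb i).1.aestronglyMeasurable) (fun i => (hf i).1.aestronglyMeasurable)
  have hR : ∀ R : ℝ, 0 < R → ∫⁻ x in Metric.ball 0 R,
      (∫⁻ t in openUnitCube m, ‖hardyCommutatorIntegrand ω b f x t‖ₑ) ^ p ≤
      (volume (Metric.ball (0 : E) R) ^ (1 / p + l) * (D * M) * hardyLogConstant n ω ls) ^ p :=
    fun R hR => setLIntegral_ball_lintegral_hardyCommutatorIntegrand_rpow_le hω_nonneg hω hp hps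
      hqs hpsum hlsum (fun i => (hb i).1) (fun i => (hf i).1) hR
  have hfin : ∀ R : ℝ, 0 < R →
      volume (Metric.ball (0 : E) R) ^ (1 / p + l) * (D * M) * hardyLogConstant n ω ls ≠ ∞ := by
    intro R hR
    refine ENNReal.mul_ne_top (ENNReal.mul_ne_top ?_ (ENNReal.mul_ne_top hDt hMt)) hK.ne
    simp [ENNReal.rpow_eq_top_iff, volume_ball_pos_ne_zero (n := n) hR,
      volume_ball_ne_top (n := n) R]
  have hnorm : ∀ R : ℝ, 0 < R →
      eLpNorm' (hardyCommutator ω b f) p (volume.restrict (Metric.ball 0 R)) ≤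
      volume (Metric.ball (0 : E) R) ^ (1 / p + l) * (D * M) * hardyLogConstant n ω ls := by
    intro R h
    refine (ENNReal.rpow_le_rpow ((lintegral_mono fun x => ?_).trans (hR R h))
      (by positivity)).trans_eq ?_
    · exact ENNReal.rpow_le_rpow (enorm_integral_le_lintegral_enorm _) hp0.le
    · rw [← ENNReal.rpow_mul, mul_one_div_cancel hp0.ne', ENNReal.rpow_one]
  have hHm : AEStronglyMeasurable (hardyCommutator ω b f) volume := hmeas.integral_prod_right'
  have hbound : centralMorreyNorm p l (hardyCommutator ω b f) ≤ D * M * hardyLogConstant n ω ls :=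
    centralMorreyNorm_le_of_eLpNorm' hp0 _ _ fun R h => by
      simpa only [mul_assoc] using hnorm R h
  refine ⟨?_, ⟨fun R h => ⟨hHm.restrict, ?_⟩, hbound.trans_lt ?_⟩, hbound.trans_eq ?_⟩
  -- The estimate was made for the integral of the norm, so it also gives absolute convergence
  -- almost everywhere on each ball; countably many balls cover the space.
  · have h1 : ∀ k : ℕ, ∀ᵐ x, x ∈ Metric.ball (0 : E) ((k : ℝ) + 1) →
        ∫⁻ t in openUnitCube m, ‖hardyCommutatorIntegrand ω b f x t‖ₑ < ∞ := by
      intro k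
      have hk : (0 : ℝ) < k + 1 := by positivity
      rw [← ae_restrict_iff' measurableSet_ball]
      have h2 := ae_lt_top' (μ := volume.restrict (Metric.ball (0 : E) ((k : ℝ) + 1)))
        (f := fun x => (∫⁻ t in openUnitCube m, ‖hardyCommutatorIntegrand ω b f x t‖ₑ) ^ p)
        ((hmeas.enorm.lintegral_prod_right').restrict.pow_const p)
        ((hR _ hk).trans_lt (ENNReal.rpow_lt_top_of_nonneg hp0.le (hfin _ hk))).ne
      filter_upwards [h2] with x hx
      rwa [ENNReal.rpow_lt_top_iff_of_pos hp0] at hx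
    filter_upwards [ae_all_iff.2 h1, hmeas.prodMk_left] with x hx hxm
    obtain ⟨k, hk⟩ := exists_nat_ge ‖x‖
    exact ⟨hxm, hx k (by simpa using hk.trans_lt (lt_add_one _))⟩
  · rw [eLpNorm_eq_eLpNorm' (by simpa using hp0) ENNReal.ofReal_ne_top,
      ENNReal.toReal_ofReal hp0.le]
    exact (hnorm R h).trans_lt (hfin R h).lt_top
  · exact (ENNReal.mul_ne_top (ENNReal.mul_ne_top hDt hMt) hK.ne).lt_top
  · rw [ENNReal.coe_toNNReal (ENNReal.mul_ne_top hDt hK.ne)]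
    ring

end Operator

/-! ### Powers and logarithms of the norm as test functions and symbols. -/

section TestFunctions

variable {n : ℕ}

local notation "E" => EuclideanSpace ℝ (Fin n)

/-- In polar coordinates the radial integrand is `y^{n - 1 + ap}`, integrable at `0` because its
exponent exceeds `-1`. -/
theorem eLpNorm'_norm_rpow_unitBall_lt_top (hn : 1 ≤ n) {a p : ℝ} (hp : 0 < p)
    (hap : -(n : ℝ) < a * p) :
    eLpNorm' (fun x : E => ((‖x‖ ^ a : ℝ) : ℂ)) p (volume.restrict (Metric.ball 0 1)) < ∞ := by
  have : Nonempty (Fin n) := ⟨⟨0, hn⟩⟩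
  refine ENNReal.rpow_lt_top_of_nonneg (by positivity) (ne_of_lt ?_)
  have hint : IntegrableOn (fun x : E => ‖x‖ ^ (a * p)) (Metric.ball 0 1) := by
    rw [integrableOn_fun_norm_addHaar (volume : Measure E) (f := fun y => y ^ (a * p)),
      finrank_euclideanSpace_fin]
    refine ((intervalIntegral.integrableOn_Ioo_rpow_iff (s := (n : ℝ) - 1 + a * p)
      one_pos).2 (by linarith)).congr_fun (fun y hy => ?_) measurableSet_Ioo
    simp only [smul_eq_mul]
    rw [Real.rpow_add hy.1, ← Real.rpow_natCast, Nat.cast_sub hn, Nat.cast_one]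
  refine lt_of_eq_of_lt (lintegral_congr fun x => ?_) hint.2
  beta_reduce
  rw [Real.rpow_mul (norm_nonneg _), Real.enorm_eq_ofReal (by positivity),
    ← ENNReal.ofReal_rpow_of_nonneg (by positivity) hp.le]
  congr 1
  rw [← ofReal_norm, Complex.norm_real, Real.norm_of_nonneg (by positivity)]

theorem eLpNorm'_log_norm_unitBall_lt_top (hn : 1 ≤ n) {q : ℝ} (hq : 0 < q) :
    eLpNorm' (fun x : E => (Real.log ‖x‖ : ℂ)) q (volume.restrict (Metric.ball 0 1)) < ∞ := by
  have hn' : (0 : ℝ) < n := by exact_mod_cast hn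
  -- On the unit ball `|log ‖x‖| ≤ τ⁻¹ ‖x‖^{-τ}`; this choice gives `-τ q = -n / 2 > -n`, so the
  -- majorant lies in `L^q`.
  set τ : ℝ := n / (2 * q) with hτ
  have hτ0 : 0 < τ := by positivity
  have h := eLpNorm'_norm_rpow_unitBall_lt_top (n := n) hn (a := -τ) hq (by
    rw [hτ]; field_simp; linarith)
  refine lt_of_le_of_lt (eLpNorm'_mono_ae (g := ((1 / τ : ℝ) : ℂ) •
    fun x : E => ((‖x‖ ^ (-τ) : ℝ) : ℂ)) hq.le ?_) ?_
  · filter_upwards [ae_restrict_mem measurableSet_ball] with x hx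
    simp only [Pi.smul_apply, smul_eq_mul, norm_mul, Complex.norm_real, Real.norm_eq_abs]
    rw [abs_of_pos (show 0 < 1 / τ by positivity),
      abs_of_nonneg (show 0 ≤ ‖x‖ ^ (-τ) by positivity)]
    rcases eq_or_ne x 0 with rfl | hx0
    · simp; positivity
    · have hx1 : 0 < ‖x‖ := norm_pos_iff.2 hx0
      have h1 := Real.abs_log_mul_self_rpow_lt ‖x‖ τ hx1 (by simpa using (mem_ball_zero_iff.1 hx).le)
        hτ0
      rw [abs_mul, abs_of_pos (show 0 < ‖x‖ ^ τ by positivity)] at h1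
      rw [Real.rpow_neg hx1.le, ← div_eq_mul_inv, le_div_iff₀ (by positivity)]
      exact h1.le
  · rw [eLpNorm'_const_smul _ hq]
    exact ENNReal.mul_lt_top (by simp) h

theorem eLpNorm'_ball_eq_comp_smul {R p : ℝ} (hR : 0 < R) (hp : 0 < p) (f : E → ℂ) :
    eLpNorm' f p (volume.restrict (Metric.ball 0 R)) =
      ENNReal.ofReal (R ^ n) ^ (1 / p) *
        eLpNorm' (fun x => f (R • x)) p (volume.restrict (Metric.ball 0 1)) := by
  have hτ0 : ENNReal.ofReal (R ^ n) ≠ 0 := by simp; positivity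
  rw [eLpNorm'_ball_comp_smul hR hp, ← mul_assoc, ← ENNReal.rpow_add _ _ hτ0 ENNReal.ofReal_ne_top,
    add_neg_cancel, ENNReal.rpow_zero, one_mul, mul_one]

theorem volume_ball_eq_mul_unitBall {R : ℝ} (hR : 0 < R) :
    volume (Metric.ball (0 : E) R) = ENNReal.ofReal (R ^ n) * volume (Metric.ball (0 : E) 1) := by
  conv_lhs => rw [← mul_one R]
  exact volume_ball_smul hR 1

/-- By homogeneity the normalised integral over `B(0,R)` does not depend on `R`, and on the unit
ball `l > -1/p` gives integrability. -/
theorem centralMorreyNorm_norm_rpow_lt_top (hn : 1 ≤ n) {p l : ℝ} (hp : 0 < p)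
    (hl : -(1 / p) < l) :
    centralMorreyNorm p l (fun x : E => ((‖x‖ ^ (n * l) : ℝ) : ℂ)) < ∞ := by
  have hn' : (0 : ℝ) < n := by exact_mod_cast hn
  have hV0 := volume_ball_pos_ne_zero (n := n) one_pos
  have hVt := volume_ball_ne_top (n := n) 1
  have h1 := eLpNorm'_norm_rpow_unitBall_lt_top (n := n) hn (a := n * l) hp (by
    have : -1 < l * p := by
      rw [neg_lt, ← neg_mul, ← lt_div_iff₀ hp] at *; linarith
    nlinarith)
  set c := eLpNorm' (fun x : E => ((‖x‖ ^ (n * l) : ℝ) : ℂ)) p (volume.restrict (Metric.ball 0 1))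
  refine lt_of_le_of_lt (centralMorreyNorm_le_of_eLpNorm' hp _
    (volume (Metric.ball (0 : E) 1) ^ (-(1 / p + l)) * c) fun R hR => ?_)
    (ENNReal.mul_lt_top (by simp [lt_top_iff_ne_top, ENNReal.rpow_eq_top_iff, hV0, hVt]) h1)
  have hτ0 : ENNReal.ofReal (R ^ n) ≠ 0 := by simp; positivity
  have h2 : (fun x : E => ((‖R • x‖ ^ (n * l) : ℝ) : ℂ)) =
      ((R ^ (n * l) : ℝ) : ℂ) • fun x : E => ((‖x‖ ^ (n * l) : ℝ) : ℂ) := by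
    ext x
    rw [norm_smul, Real.norm_of_nonneg hR.le, Real.mul_rpow hR.le (norm_nonneg _)]
    simp
  have h3 : ‖((R ^ (n * l) : ℝ) : ℂ)‖ₑ = ENNReal.ofReal (R ^ n) ^ l := by
    rw [← ofReal_norm, Complex.norm_real, Real.norm_of_nonneg (by positivity),
      ENNReal.ofReal_rpow_of_pos (by positivity), Real.rpow_mul hR.le, Real.rpow_natCast]
  rw [eLpNorm'_ball_eq_comp_smul hR hp, h2, eLpNorm'_const_smul _ hp, h3,
    volume_ball_eq_mul_unitBall hR, ENNReal.mul_rpow_of_ne_top ENNReal.ofReal_ne_top hVt,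
    ENNReal.rpow_add _ _ hτ0 ENNReal.ofReal_ne_top]
  calc _ = ENNReal.ofReal (R ^ n) ^ (1 / p) * ENNReal.ofReal (R ^ n) ^ l *
      (volume (Metric.ball (0 : E) 1) ^ (1 / p + l) *
        volume (Metric.ball (0 : E) 1) ^ (-(1 / p + l))) * c := by
        rw [← ENNReal.rpow_add _ _ hV0 hVt]; simp; ring
    _ ≤ _ := by apply le_of_eq; ring

/-- The power `‖x‖ ^ a` truncated to the complement of the ball of radius `ε`. -/
noncomputable def truncPow (a ε : ℝ) (x : E) : ℂ := if ε < ‖x‖ then ((‖x‖ ^ a : ℝ) : ℂ) else 0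

theorem measurable_truncPow (a ε : ℝ) : Measurable (truncPow (n := n) a ε) := by
  unfold truncPow
  refine Measurable.ite (measurableSet_lt measurable_const measurable_norm) ?_ measurable_const
  fun_prop

theorem norm_truncPow_le (a ε : ℝ) (x : E) : ‖truncPow a ε x‖ ≤ ‖((‖x‖ ^ a : ℝ) : ℂ)‖ := by
  unfold truncPow
  split_ifs <;> simp

theorem centralMorreyNorm_truncPow_le {p : ℝ} (hp : 0 < p) (l a ε : ℝ) :
    centralMorreyNorm p l (truncPow (n := n) a ε) ≤
      centralMorreyNorm p l (fun x : E => ((‖x‖ ^ a : ℝ) : ℂ)) :=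
  centralMorreyNorm_le_of_eLpNorm' hp _ _ fun _ hR =>
    (eLpNorm'_mono_ae hp.le (Filter.Eventually.of_forall fun x => norm_truncPow_le a ε x)).trans
      (eLpNorm'_ball_le_centralMorreyNorm hp hR _)

theorem MemCentralMorrey.of_norm_lt_top {p l : ℝ} (hp : 0 < p) {f : E → ℂ}
    (hf : AEStronglyMeasurable f volume) (h : centralMorreyNorm p l f < ∞) :
    MemCentralMorrey p l f := by
  refine ⟨fun R hR => ⟨hf.restrict, ?_⟩, h⟩
  rw [eLpNorm_eq_eLpNorm' (by simpa using hp) ENNReal.ofReal_ne_top, ENNReal.toReal_ofReal hp.le]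
  refine (eLpNorm'_ball_le_centralMorreyNorm hp hR f).trans_lt (ENNReal.mul_lt_top ?_ h)
  simp [lt_top_iff_ne_top, ENNReal.rpow_eq_top_iff, volume_ball_pos_ne_zero (n := n) hR,
    volume_ball_ne_top (n := n) R]

theorem memCentralMorrey_truncPow (hn : 1 ≤ n) {p l : ℝ} (hp : 0 < p) (hl : -(1 / p) < l)
    (ε : ℝ) : MemCentralMorrey p l (truncPow (n := n) (n * l) ε) :=
  .of_norm_lt_top hp (measurable_truncPow _ _).aestronglyMeasurable
    ((centralMorreyNorm_truncPow_le hp l _ ε).trans_lt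
      (centralMorreyNorm_norm_rpow_lt_top hn hp hl))

/-- Oscillation about arbitrary constants suffices: the average over the ball is no farther from `c
R` than the mean deviation, so recentring at most doubles the bound. -/
theorem memCentralBMO_of_forall_eLpNorm'_sub_const_le {q : ℝ} (hq : 1 ≤ q) {b : E → ℂ}
    (hb : AEStronglyMeasurable b volume) (c : ℝ → ℂ) {C : ℝ≥0∞} (hC : C < ∞)
    (h : ∀ R, 0 < R → eLpNorm' (fun x => b x - c R) q (volume.restrict (Metric.ball 0 R)) ≤
      volume (Metric.ball (0 : E) R) ^ (1 / q) * C) : MemCentralBMO q b := by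
  have hq0 : 0 < q := by linarith
  have hVq : ∀ R, volume (Metric.ball (0 : E) R) ^ (1 / q) < ∞ := fun R =>
    ENNReal.rpow_lt_top_of_nonneg (by positivity) (volume_ball_ne_top R)
  have hloc : LocallyLp q b := by
    intro R hR
    refine ⟨hb.restrict, ?_⟩
    rw [eLpNorm_eq_eLpNorm' (by simpa using hq0) ENNReal.ofReal_ne_top,
      ENNReal.toReal_ofReal hq0.le]
    have e : b = (fun x => b x - c R) - fun _ => -c R := by ext x; simp
    rw [e]
    refine (eLpNorm'_sub_le hq (hb.sub aestronglyMeasurable_const).restrict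
      aestronglyMeasurable_const).trans_lt (ENNReal.add_lt_top.2 ⟨?_, ?_⟩)
    · exact (h R hR).trans_lt (ENNReal.mul_lt_top (hVq R) hC)
    · rw [eLpNorm'_const _ hq0, Measure.restrict_apply_univ]
      exact ENNReal.mul_lt_top (by simp) (hVq R)
  refine ⟨hloc, lt_of_le_of_lt (iSup₂_le (a := 2 * C) fun R hR => ?_)
    (ENNReal.mul_lt_top (by simp) hC)⟩
  have hV0 := volume_ball_pos_ne_zero (n := n) hR
  have hVt := volume_ball_ne_top (n := n) R
  have : IsFiniteMeasure ((volume : Measure E).restrict (Metric.ball 0 R)) :=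
    ⟨by simpa using measure_ball_lt_top⟩
  rw [ENNReal.div_rpow_of_nonneg _ _ (by positivity),
    ENNReal.div_le_iff (by simp [ENNReal.rpow_eq_zero_iff, hV0, hVt]) (hVq R).ne]
  have h1 := enorm_average_sub_const_le (μ := (volume : Measure E).restrict
    (Metric.ball 0 R)) (by simpa [Measure.restrict_eq_zero] using hV0) hq
    (hloc.integrableOn_ball hq hR) (c R)
  rw [Measure.restrict_apply_univ] at h1
  set a := ⨍ y in Metric.ball 0 R, b y
  have e : (fun x => b x - a) = (fun x => b x - c R) - fun _ => a - c R := by ext x; simp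
  change eLpNorm' (fun x => b x - a) q _ ≤ _
  rw [e]
  refine (eLpNorm'_sub_le hq (hb.sub aestronglyMeasurable_const).restrict
      aestronglyMeasurable_const).trans ?_
  rw [eLpNorm'_const _ hq0, Measure.restrict_apply_univ]
  calc _ ≤ volume (Metric.ball (0 : E) R) ^ (1 / q) * C +
      (volume (Metric.ball (0 : E) R) ^ (1 / q) * C * volume (Metric.ball (0 : E) R) ^ (-(1 / q)))
        * volume (Metric.ball (0 : E) R) ^ (1 / q) := by
        gcongr
        · exact h R hR
        · exact h1.trans (by gcongr; exact h R hR)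
    _ = volume (Metric.ball (0 : E) R) ^ (1 / q) * C +
      volume (Metric.ball (0 : E) R) ^ (1 / q) * C * (volume (Metric.ball (0 : E) R) ^ (-(1 / q))
        * volume (Metric.ball (0 : E) R) ^ (1 / q)) := by ring
    _ = _ := by
        rw [← ENNReal.rpow_add _ _ hV0 hVt, neg_add_cancel, ENNReal.rpow_zero]; ring

theorem memCentralBMO_of_bounded {q : ℝ} (hq : 1 ≤ q) {b : E → ℂ}
    (hb : AEStronglyMeasurable b volume) {A : ℝ} (hA : ∀ x, ‖b x‖ ≤ A) : MemCentralBMO q b := by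
  have hq0 : 0 < q := by linarith
  refine memCentralBMO_of_forall_eLpNorm'_sub_const_le hq hb (fun _ => 0)
    (C := ‖A‖ₑ) (by simp) fun R hR => ?_
  refine (eLpNorm'_mono_ae (g := fun _ : E => A) hq0.le
    (Filter.Eventually.of_forall fun x => ?_)).trans_eq ?_
  · simpa using (hA x).trans (le_abs_self A)
  · rw [eLpNorm'_const _ hq0, Measure.restrict_apply_univ, mul_comm]

/-- Since `log ‖R x‖ - log R = log ‖x‖`, centring at `log R` reduces every ball to the unit ball. -/
theorem memCentralBMO_log_norm (hn : 1 ≤ n) {q : ℝ} (hq : 1 ≤ q) :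
    MemCentralBMO q (fun x : E => (Real.log ‖x‖ : ℂ)) := by
  have hq0 : 0 < q := by linarith
  have : Nonempty (Fin n) := ⟨⟨0, hn⟩⟩
  have hV0 := volume_ball_pos_ne_zero (n := n) one_pos
  have hVt := volume_ball_ne_top (n := n) 1
  have h1 := eLpNorm'_log_norm_unitBall_lt_top (n := n) hn hq0
  refine memCentralBMO_of_forall_eLpNorm'_sub_const_le hq
    (Measurable.aestronglyMeasurable (by fun_prop)) (fun R => (Real.log R : ℂ))
    (C := volume (Metric.ball (0 : E) 1) ^ (-(1 / q)) *
      eLpNorm' (fun x : E => (Real.log ‖x‖ : ℂ)) q (volume.restrict (Metric.ball 0 1)))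
    (ENNReal.mul_lt_top (by simp [lt_top_iff_ne_top, ENNReal.rpow_eq_top_iff, hV0, hVt]) h1)
    fun R hR => ?_
  have e : eLpNorm' (fun x : E => (Real.log ‖R • x‖ : ℂ) - (Real.log R : ℂ)) q
      (volume.restrict (Metric.ball 0 1)) =
      eLpNorm' (fun x : E => (Real.log ‖x‖ : ℂ)) q (volume.restrict (Metric.ball 0 1)) := by
    refine eLpNorm'_congr_ae (ae_restrict_of_ae ?_)
    filter_upwards [Measure.ae_ne volume (0 : E)] with x hx
    rw [norm_smul, Real.norm_of_nonneg hR.le, Real.log_mul hR.ne' (norm_ne_zero_iff.2 hx)]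
    push_cast
    ring
  rw [eLpNorm'_ball_eq_comp_smul hR hq0, e, volume_ball_eq_mul_unitBall hR,
    ENNReal.mul_rpow_of_ne_top ENNReal.ofReal_ne_top hVt]
  apply le_of_eq
  calc _ = ENNReal.ofReal (R ^ n) ^ (1 / q) * (volume (Metric.ball (0 : E) 1) ^ (1 / q) *
        volume (Metric.ball (0 : E) 1) ^ (-(1 / q))) *
        eLpNorm' (fun x : E => (Real.log ‖x‖ : ℂ)) q (volume.restrict (Metric.ball 0 1)) := by
        rw [← ENNReal.rpow_add _ _ hV0 hVt, add_neg_cancel, ENNReal.rpow_zero, mul_one]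
    _ = _ := by ring

end TestFunctions

/-! ### From increments to the full integral: uniform boundedness and Cesàro averaging. -/

section Oscillation

open Filter
open scoped Topology BoundedContinuousFunction

/-- The geometric sums of a unimodular `w ≠ 1` stay below `2 / ‖w - 1‖`. -/
theorem tendsto_average_exp_mul_I {h : ℝ} (hh : Complex.exp (-(h * Complex.I)) ≠ 1) :
    Tendsto (fun M : ℕ => ((M : ℂ) + 1)⁻¹ *
      ∑ N ∈ Finset.range (M + 1), Complex.exp (-(h * Complex.I)) ^ N) atTop (𝓝 0) := by
  set w := Complex.exp (-(h * Complex.I))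
  have hw : ‖w‖ = 1 := by
    have := Complex.norm_exp_ofReal_mul_I (-h)
    simpa [w] using this
  have hw1 : 0 < ‖w - 1‖ := norm_pos_iff.2 (sub_ne_zero.2 hh)
  refine squeeze_zero_norm (a := fun M : ℕ => ((M : ℝ) + 1)⁻¹ * (2 / ‖w - 1‖)) (fun M => ?_) ?_
  · rw [norm_mul, geom_sum_eq hh, norm_div, norm_inv]
    have h1 : ‖(M : ℂ) + 1‖ = (M : ℝ) + 1 := by
      rw [← Nat.cast_succ, Complex.norm_natCast]; simp
    rw [h1]
    gcongr
    refine (norm_sub_le _ _).trans ?_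
    rw [norm_pow, hw]; norm_num
  · have h2 := (tendsto_one_div_add_atTop_nhds_zero_nat (𝕜 := ℝ)).mul_const (2 / ‖w - 1‖)
    simpa using h2

/-- Boundedness of all the pairings with increments of bounded continuous functions implies
boundedness of the integrals themselves, for a family of kernels stable under modulation. -/
theorem exists_forall_norm_integral_le_of_increments {Z : Type*} [MeasurableSpace Z]
    {P : Measure Z} {s h : Z → ℝ} (hs : Measurable s) (hh : Measurable h)
    (hh1 : ∀ᵐ z ∂P, Complex.exp (-(h z * Complex.I)) ≠ 1)
    (F : Set (Z → ℂ)) (hF : ∀ Φ ∈ F, Integrable Φ P)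
    (hmod : ∀ Φ ∈ F, ∀ N : ℕ, (fun z => Complex.exp (-(N * s z * Complex.I)) * Φ z) ∈ F)
    (hbdd : ∀ β : ℝ →ᵇ ℂ, ∃ C : ℝ, ∀ Φ ∈ F, ‖∫ z, Φ z * (β (s z) - β (s z - h z)) ∂P‖ ≤ C) :
    ∃ C : ℝ, ∀ Φ ∈ F, ‖∫ z, Φ z ∂P‖ ≤ C := by
  have hint : ∀ Φ ∈ F, ∀ β : ℝ →ᵇ ℂ,
      Integrable (fun z => Φ z * (β (s z) - β (s z - h z))) P := by
    intro Φ hΦ β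
    have hm : Measurable fun z => β (s z) - β (s z - h z) :=
      (β.continuous.measurable.comp hs).sub (β.continuous.measurable.comp (hs.sub hh))
    have := (hF Φ hΦ).bdd_mul (c := 2 * ‖β‖) hm.aestronglyMeasurable (ae_of_all _ fun z => by
      refine (norm_sub_le _ _).trans ?_
      linarith [β.norm_coe_le_norm (s z), β.norm_coe_le_norm (s z - h z)])
    simpa only [mul_comm] using this
  let T : F → (ℝ →ᵇ ℂ) →L[ℂ] ℂ := fun Φ => LinearMap.mkContinuous
    { toFun := fun β => ∫ z, Φ.1 z * (β (s z) - β (s z - h z)) ∂P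
      map_add' := fun β γ => by
        rw [← integral_add (hint _ Φ.2 β) (hint _ Φ.2 γ)]
        refine integral_congr_ae (ae_of_all _ fun z => ?_)
        simp only [BoundedContinuousFunction.add_apply]
        ring
      map_smul' := fun c β => by
        rw [RingHom.id_apply, smul_eq_mul, ← integral_const_mul]
        refine integral_congr_ae (ae_of_all _ fun z => ?_)
        simp only [BoundedContinuousFunction.smul_apply, smul_eq_mul]
        ring }
    (∫ z, ‖Φ.1 z‖ * 2 ∂P) (fun β => by
      simp only [LinearMap.coe_mk, AddHom.coe_mk]
      rw [← integral_mul_const]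
      refine norm_integral_le_of_norm_le (((hF _ Φ.2).norm.mul_const 2).mul_const _)
        (ae_of_all _ fun z => ?_)
      rw [norm_mul, mul_assoc]
      gcongr
      refine (norm_sub_le _ _).trans ?_
      linarith [β.norm_coe_le_norm (s z), β.norm_coe_le_norm (s z - h z)])
  -- The constant in `hbdd` may depend on `β`; completeness of the bounded continuous functions
  -- provides one bound for all the operator norms.
  obtain ⟨C, hC⟩ := banach_steinhaus (g := T) fun β => by
    obtain ⟨C, hC⟩ := hbdd β
    exact ⟨C, fun Φ => hC Φ.1 Φ.2⟩
  refine ⟨C, fun Φ hΦ => ?_⟩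
  let χ : ℕ → ℝ →ᵇ ℂ := fun N => BoundedContinuousFunction.ofNormedAddCommGroup
    (fun u : ℝ => Complex.exp (((N * u : ℝ) : ℂ) * Complex.I)) (by fun_prop) 1
    (fun u => (Complex.norm_exp_ofReal_mul_I _).le)
  have hχ : ∀ N, ‖χ N‖ ≤ 1 := fun N =>
    BoundedContinuousFunction.norm_ofNormedAddCommGroup_le _ zero_le_one _
  -- Pair the character `e^{iNu}`, of norm at most `1`, with the modulated kernel `e^{-iNs} Φ`: the
  -- phases in `s` cancel and only `h` survives.
  have hphase : ∀ N : ℕ, ‖∫ z, Φ z * (1 - Complex.exp (-(h z * Complex.I)) ^ N) ∂P‖ ≤ C := by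
    intro N
    have h1 := (T ⟨_, hmod Φ hΦ N⟩).le_opNorm (χ N)
    have h2 : T ⟨_, hmod Φ hΦ N⟩ (χ N) =
        ∫ z, Φ z * (1 - Complex.exp (-(h z * Complex.I)) ^ N) ∂P := by
      change ∫ z, _ ∂P = _
      refine integral_congr_ae (ae_of_all _ fun z => ?_)
      simp only [χ, BoundedContinuousFunction.coe_ofNormedAddCommGroup]
      have e1 : Complex.exp (-(N * s z * Complex.I)) *
          Complex.exp (((N * s z : ℝ) : ℂ) * Complex.I) = 1 := by
        rw [← Complex.exp_add]; simp
      have e2 : Complex.exp (-(N * s z * Complex.I)) *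
          Complex.exp (((N * (s z - h z) : ℝ) : ℂ) * Complex.I) =
          Complex.exp (-(h z * Complex.I)) ^ N := by
        rw [← Complex.exp_add, ← Complex.exp_nat_mul]
        congr 1
        push_cast
        ring
      rw [← e2, ← e1]
      ring
    rw [h2] at h1
    refine h1.trans ?_
    calc _ ≤ ‖T ⟨_, hmod Φ hΦ N⟩‖ * 1 := by gcongr; exact hχ N
      _ ≤ C := by rw [mul_one]; exact hC _
  have hw : ∀ z, ‖Complex.exp (-(h z * Complex.I))‖ = 1 := fun z => by
    have := Complex.norm_exp_ofReal_mul_I (-(h z))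
    simpa using this
  have hwm : Measurable fun z => Complex.exp (-(h z * Complex.I)) := by fun_prop
  have hpint : ∀ N : ℕ,
      Integrable (fun z => Φ z * (1 - Complex.exp (-(h z * Complex.I)) ^ N)) P := by
    intro N
    have := (hF Φ hΦ).bdd_mul (c := 2)
      (f := fun z => 1 - Complex.exp (-(h z * Complex.I)) ^ N)
      (measurable_const.sub (hwm.pow_const N)).aestronglyMeasurable (ae_of_all _ fun z => by
        refine (norm_sub_le _ _).trans ?_
        rw [norm_pow, hw]; norm_num)
    simpa only [mul_comm] using this
  have havg : ∀ M : ℕ, ‖∫ z, Φ z * (1 - ((M : ℂ) + 1)⁻¹ *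
      ∑ N ∈ Finset.range (M + 1), Complex.exp (-(h z * Complex.I)) ^ N) ∂P‖ ≤ C := by
    intro M
    have hM : ((M : ℂ) + 1) ≠ 0 := by exact_mod_cast Nat.succ_ne_zero M
    have h1 : ‖(M : ℂ) + 1‖ = (M : ℝ) + 1 := by
      rw [← Nat.cast_succ, Complex.norm_natCast]; simp
    have e : ∫ z, Φ z * (1 - ((M : ℂ) + 1)⁻¹ *
        ∑ N ∈ Finset.range (M + 1), Complex.exp (-(h z * Complex.I)) ^ N) ∂P =
        ((M : ℂ) + 1)⁻¹ * ∑ N ∈ Finset.range (M + 1),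
          ∫ z, Φ z * (1 - Complex.exp (-(h z * Complex.I)) ^ N) ∂P := by
      rw [← integral_finsetSum _ fun N _ => hpint N, ← integral_const_mul]
      refine integral_congr_ae (ae_of_all _ fun z => ?_)
      simp only [← Finset.mul_sum, Finset.sum_sub_distrib, Finset.sum_const, Finset.card_range,
        nsmul_eq_mul, mul_one]
      push_cast
      field_simp
    rw [e, norm_mul, norm_inv, h1, inv_mul_le_iff₀ (by positivity)]
    refine (norm_sum_le_of_le _ fun N _ => hphase N).trans_eq ?_
    simp
  have hlim : Tendsto (fun M : ℕ => ∫ z, Φ z * (1 - ((M : ℂ) + 1)⁻¹ *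
      ∑ N ∈ Finset.range (M + 1), Complex.exp (-(h z * Complex.I)) ^ N) ∂P) atTop
      (𝓝 (∫ z, Φ z ∂P)) := by
    refine tendsto_integral_of_dominated_convergence (fun z => ‖Φ z‖ * 2) (fun M => ?_)
      ((hF Φ hΦ).norm.mul_const 2) (fun M => ae_of_all _ fun z => ?_) ?_
    · refine (hF Φ hΦ).1.mul (Measurable.aestronglyMeasurable ?_)
      fun_prop
    · rw [norm_mul]
      gcongr
      refine (norm_sub_le _ _).trans ?_
      have h1 : ‖(M : ℂ) + 1‖ = (M : ℝ) + 1 := by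
        rw [← Nat.cast_succ, Complex.norm_natCast]; simp
      have h2 : ‖∑ N ∈ Finset.range (M + 1), Complex.exp (-(h z * Complex.I)) ^ N‖ ≤
          (M : ℝ) + 1 := by
        refine (norm_sum_le _ _).trans_eq ?_
        simp [norm_pow, hw]
      rw [norm_mul, norm_inv, h1, norm_one]
      have : ((M : ℝ) + 1)⁻¹ *
          ‖∑ N ∈ Finset.range (M + 1), Complex.exp (-(h z * Complex.I)) ^ N‖ ≤ 1 := by
        rw [inv_mul_le_iff₀ (by positivity), mul_one]; exact h2
      linarith
    · filter_upwards [hh1] with z hz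
      have := ((tendsto_average_exp_mul_I hz).const_sub 1).const_mul (Φ z)
      simpa using this
  exact le_of_tendsto hlim.norm (Eventually.of_forall havg)

end Oscillation

/-! ### Necessity: finiteness of the constant from boundedness for all symbols. -/

section Necessity

open Filter
open scoped Topology BoundedContinuousFunction

variable {n m : ℕ}

local notation "E" => EuclideanSpace ℝ (Fin n)

/-- Lebesgue measure on the product of the unit ball and the open unit cube. -/
noncomputable def ballCubeMeasure (n m : ℕ) :
    Measure (EuclideanSpace ℝ (Fin n) × (Fin m → ℝ)) :=
  (volume.restrict (Metric.ball 0 1)).prod (volume.restrict (openUnitCube m))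

/-- The integrand of the commutator on truncated powers, with the increments of the symbols
replaced by arbitrary multipliers `d`, paired with `ψ`. -/
noncomputable def testKernel (ω : (Fin m → ℝ) → ℝ) (ls : Fin m → ℝ) (ε : ℝ)
    (ψ : EuclideanSpace ℝ (Fin n) → ℂ) (d : Fin m → EuclideanSpace ℝ (Fin n) → ℝ → ℂ)
    (z : EuclideanSpace ℝ (Fin n) × (Fin m → ℝ)) : ℂ :=
  ψ z.1 * (∏ i, truncPow (n * ls i) ε (z.2 i • z.1) * d i z.1 (z.2 i)) * (ω z.2 : ℂ)

/-- Multipliers that grow at most like `log (2 / t)`. -/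
structure IsLogMultiplier (d : EuclideanSpace ℝ (Fin n) → ℝ → ℂ) : Prop where
  measurable : Measurable (Function.uncurry d)
  bound : ∃ A : ℝ, ∀ x, x ≠ 0 → ∀ t, 0 < t → t < 1 → ‖d x t‖ ≤ A * Real.log (2 / t)

/-- The integrals of the test kernels are bounded uniformly in the truncation and the pairing. -/
def HasBoundedPairings (ω : (Fin m → ℝ) → ℝ) (ls : Fin m → ℝ)
    (d : Fin m → EuclideanSpace ℝ (Fin n) → ℝ → ℂ) : Prop :=
  ∃ C : ℝ, ∀ ε : ℝ, 0 < ε → ∀ ψ : EuclideanSpace ℝ (Fin n) → ℂ, Measurable ψ →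
    (∀ x, ‖ψ x‖ ≤ 1) → ‖∫ z, testKernel ω ls ε ψ d z ∂ballCubeMeasure n m‖ ≤ C

theorem ae_ballCubeMeasure (hn : 1 ≤ n) : ∀ᵐ z ∂ballCubeMeasure n m,
    z.1 ≠ 0 ∧ ‖z.1‖ < 1 ∧ z.2 ∈ openUnitCube m := by
  have : Nonempty (Fin n) := ⟨⟨0, hn⟩⟩
  have h1 : ∀ᵐ x ∂(volume : Measure E).restrict (Metric.ball 0 1), x ≠ 0 ∧ ‖x‖ < 1 := by
    filter_upwards [ae_restrict_of_ae (Measure.ae_ne volume (0 : E)),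
      ae_restrict_mem measurableSet_ball] with x hx hx1
    exact ⟨hx, mem_ball_zero_iff.1 hx1⟩
  filter_upwards [Measure.quasiMeasurePreserving_fst.ae h1, Measure.quasiMeasurePreserving_snd.ae
    (ae_restrict_mem (measurableSet_openUnitCube m))] with z hz1 hz2
  exact ⟨hz1.1, hz1.2, hz2⟩

/-- The exceptional points satisfy `t j = e^{2πk}` for an integer `k`: a countable union of null
hyperplanes. -/
theorem ae_ballCubeMeasure_exp_log_ne_one (j : Fin m) : ∀ᵐ z ∂ballCubeMeasure n m,
    Complex.exp (-((-Real.log (z.2 j) : ℝ) * Complex.I)) ≠ 1 := by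
  have h1 : ∀ᵐ t ∂(volume : Measure (Fin m → ℝ)).restrict (openUnitCube m),
      Complex.exp (-((-Real.log (t j) : ℝ) * Complex.I)) ≠ 1 := by
    have h2 : ∀ k : ℤ, ∀ᵐ t ∂(volume : Measure (Fin m → ℝ)).restrict (openUnitCube m),
        t j ≠ Real.exp (k * (2 * Real.pi)) := fun k => by
      refine ae_restrict_of_ae ?_
      rw [ae_iff]
      simpa [volume_pi] using Measure.pi_hyperplane (fun _ : Fin m => (volume : Measure ℝ)) j
        (Real.exp (k * (2 * Real.pi)))
    filter_upwards [ae_all_iff.2 h2, ae_restrict_mem (measurableSet_openUnitCube m)] with t ht htc h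
    obtain ⟨k, hk⟩ := Complex.exp_eq_one_iff.1 h
    refine ht k ?_
    rw [← Real.exp_log (htc j).1]
    congr 1
    have := congrArg Complex.im hk
    simpa using this
  exact Measure.quasiMeasurePreserving_snd.ae h1

theorem aestronglyMeasurable_testKernel {ω : (Fin m → ℝ) → ℝ}
    (hω : AEStronglyMeasurable ω (volume.restrict (openUnitCube m))) (ls : Fin m → ℝ) (ε : ℝ)
    {ψ : E → ℂ} (hψ : Measurable ψ) {d : Fin m → E → ℝ → ℂ} (hd : ∀ i, IsLogMultiplier (d i)) :
    AEStronglyMeasurable (testKernel ω ls ε ψ d) (ballCubeMeasure n m) := by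
  refine AEStronglyMeasurable.mul (Measurable.aestronglyMeasurable ?_) ?_
  · refine (hψ.comp measurable_fst).mul (Finset.measurable_fun_prod _ fun i _ => ?_)
    refine ((measurable_truncPow _ _).comp (by fun_prop)).mul ?_
    exact (hd i).measurable.comp
      (measurable_fst.prodMk ((measurable_pi_apply i).comp measurable_snd))
  · exact (Complex.continuous_ofReal.comp_aestronglyMeasurable hω).comp_snd

theorem integrable_testKernel (hn : 1 ≤ n) {ω : (Fin m → ℝ) → ℝ}
    (hω : IntegrableOn ω (openUnitCube m)) {ls : Fin m → ℝ} (hls : ∀ i, ls i < 0) {ε : ℝ}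
    (hε : 0 < ε) {ψ : E → ℂ} (hψ : Measurable ψ) (hψ1 : ∀ x, ‖ψ x‖ ≤ 1)
    {d : Fin m → E → ℝ → ℂ} (hd : ∀ i, IsLogMultiplier (d i)) :
    Integrable (testKernel ω ls ε ψ d) (ballCubeMeasure n m) := by
  choose A hA using fun i => (hd i).bound
  have : IsFiniteMeasure ((volume : Measure E).restrict (Metric.ball 0 1)) :=
    ⟨by simpa using measure_ball_lt_top⟩
  have hω' : Integrable (fun z : E × (Fin m → ℝ) => (ω z.2 : ℂ)) (ballCubeMeasure n m) :=
    (hω.ofReal (𝕜 := ℂ)).comp_snd _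
  set B : Fin m → ℝ := fun i => ε ^ (n * ls i) * (|A i| * |Real.log (2 / ε)|)
  refine (hω'.norm.const_mul (∏ i, B i)).mono'
    (aestronglyMeasurable_testKernel hω.aestronglyMeasurable ls ε hψ hd) ?_
  filter_upwards [ae_ballCubeMeasure hn] with z ⟨hz0, hz1, hzc⟩
  have hfac : ∀ i, ‖truncPow (n * ls i) ε (z.2 i • z.1) * d i z.1 (z.2 i)‖ ≤ B i := by
    intro i
    have hB : 0 ≤ B i := by positivity
    have ht := hzc i
    rw [truncPow]
    split_ifs with h
    · rw [norm_mul, Complex.norm_real, Real.norm_of_nonneg (by positivity)]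
      refine mul_le_mul (Real.rpow_le_rpow_of_nonpos hε h.le
        (mul_nonpos_of_nonneg_of_nonpos (by positivity) (hls i).le)) ?_ (norm_nonneg _)
        (by positivity)
      rw [norm_smul, Real.norm_of_nonneg ht.1.le] at h
      -- As `‖x‖ < 1`, the truncation `ε < ‖t_i x‖` keeps `t_i` above `ε`, so both the power and the
      -- logarithm are bounded.
      have hεt : ε < z.2 i := by nlinarith [norm_nonneg z.1]
      refine (hA i _ hz0 _ ht.1 ht.2).trans ?_
      refine mul_le_mul (le_abs_self _) ?_ (log_two_div_pos ht.1 ht.2).le (abs_nonneg _)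
      refine le_trans (Real.log_le_log (by have := ht.1; positivity) ?_) (le_abs_self _)
      gcongr
    · simpa using hB
  rw [testKernel, norm_mul, norm_mul]
  refine mul_le_mul_of_nonneg_right ?_ (norm_nonneg _)
  rw [norm_prod, ← one_mul (∏ i, B i)]
  exact mul_le_mul (hψ1 _) (Finset.prod_le_prod (fun _ _ => norm_nonneg _) fun i _ => hfac i)
    (Finset.prod_nonneg fun _ _ => norm_nonneg _) zero_le_one

theorem testKernel_update (ω : (Fin m → ℝ) → ℝ) (ls : Fin m → ℝ) (ε : ℝ) (ψ : E → ℂ)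
    (d : Fin m → E → ℝ → ℂ) (j : Fin m) (u : E → ℝ → ℂ) (z : E × (Fin m → ℝ)) :
    testKernel ω ls ε ψ (Function.update d j u) z =
      testKernel ω ls ε ψ (Function.update d j fun _ _ => 1) z * u z.1 (z.2 j) := by
  have h : ∀ v : E → ℝ → ℂ,
      ∏ i, truncPow (n * ls i) ε (z.2 i • z.1) * (Function.update d j v) i z.1 (z.2 i) =
      (truncPow (n * ls j) ε (z.2 j • z.1) * v z.1 (z.2 j)) *
        ∏ i ∈ Finset.univ.erase j, truncPow (n * ls i) ε (z.2 i • z.1) * d i z.1 (z.2 i) := by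
    intro v
    rw [← Finset.mul_prod_erase _ _ (Finset.mem_univ j), Function.update_self]
    congr 1
    refine Finset.prod_congr rfl fun i hi => ?_
    rw [Function.update_of_ne (Finset.ne_of_mem_erase hi)]
  rw [testKernel, testKernel, h, h]
  ring

theorem log_two_le_log_two_div {t : ℝ} (ht : 0 < t) (ht1 : t < 1) :
    Real.log 2 ≤ Real.log (2 / t) := by
  refine Real.log_le_log (by norm_num) ?_
  rw [le_div_iff₀ ht]; linarith

theorem IsLogMultiplier.of_bounded {d : E → ℝ → ℂ} (hd : Measurable (Function.uncurry d)) {A : ℝ}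
    (hA : ∀ x t, ‖d x t‖ ≤ A) : IsLogMultiplier d := by
  have hl2 : 0 < Real.log 2 := Real.log_pos (by norm_num)
  refine ⟨hd, A / Real.log 2, fun x _ t ht ht1 => (hA x t).trans ?_⟩
  have hA0 : 0 ≤ A := (norm_nonneg _).trans (hA x t)
  rw [div_mul_eq_mul_div, le_div_iff₀ hl2]
  exact mul_le_mul_of_nonneg_left (log_two_le_log_two_div ht ht1) hA0

theorem isLogMultiplier_log_two_div :
    IsLogMultiplier (fun (_ : E) (t : ℝ) => (Real.log (2 / t) : ℂ)) := by
  refine ⟨by unfold Function.uncurry; fun_prop, 1, fun x _ t ht ht1 => ?_⟩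
  rw [Complex.norm_real, Real.norm_of_nonneg (log_two_div_pos ht ht1).le, one_mul]

theorem IsLogMultiplier.update {d : Fin m → E → ℝ → ℂ} (hd : ∀ i, IsLogMultiplier (d i))
    (j : Fin m) {u : E → ℝ → ℂ} (hu : IsLogMultiplier u) (i : Fin m) :
    IsLogMultiplier (Function.update d j u i) := by
  rcases eq_or_ne i j with rfl | h
  · rwa [Function.update_self]
  · rw [Function.update_of_ne h]; exact hd i

/-- Apply the abstract principle with `s = log ‖x‖` and `h = -log t_j`, so that `s - h = log ‖t_j
x‖`. The modulation `e^{-iNs}` depends on `x` alone and is absorbed into `ψ`; this is why the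
pairings run over all `ψ` bounded by `1`. -/
theorem HasBoundedPairings.update_one (hn : 1 ≤ n) {ω : (Fin m → ℝ) → ℝ}
    (hω : IntegrableOn ω (openUnitCube m)) {ls : Fin m → ℝ} (hls : ∀ i, ls i < 0)
    {d : Fin m → E → ℝ → ℂ} (hd : ∀ i, IsLogMultiplier (d i)) (j : Fin m)
    (h : ∀ β : ℝ →ᵇ ℂ, HasBoundedPairings ω ls (Function.update d j fun x t =>
      β (Real.log ‖x‖) - β (Real.log ‖t • x‖))) :
    HasBoundedPairings ω ls (Function.update d j fun _ _ => 1) := by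
  have hd1 := IsLogMultiplier.update hd j
    (IsLogMultiplier.of_bounded (d := fun (_ : E) (_ : ℝ) => (1 : ℂ)) (A := 1)
      measurable_const (by simp))
  obtain ⟨C, hC⟩ := exists_forall_norm_integral_le_of_increments (P := ballCubeMeasure n m)
    (s := fun z => Real.log ‖z.1‖) (h := fun z => -Real.log (z.2 j)) (by fun_prop) (by fun_prop)
    (ae_ballCubeMeasure_exp_log_ne_one j)
    {Φ | ∃ ε : ℝ, 0 < ε ∧ ∃ ψ : E → ℂ, Measurable ψ ∧ (∀ x, ‖ψ x‖ ≤ 1) ∧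
      Φ = testKernel ω ls ε ψ (Function.update d j fun _ _ => 1)}
    (by
      rintro _ ⟨ε, hε, ψ, hψ, hψ1, rfl⟩
      exact integrable_testKernel hn hω hls hε hψ hψ1 hd1)
    (by
      rintro _ ⟨ε, hε, ψ, hψ, hψ1, rfl⟩ N
      refine ⟨ε, hε, fun x => Complex.exp (-(N * Real.log ‖x‖ * Complex.I)) * ψ x,
        by fun_prop, fun x => ?_, ?_⟩
      · rw [norm_mul]
        have := Complex.norm_exp_ofReal_mul_I (-(N * Real.log ‖x‖))
        push_cast at this
        rw [← neg_mul, this, one_mul]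
        exact hψ1 x
      · ext z
        simp only [testKernel]
        ring)
    (by
      intro β
      obtain ⟨C, hC⟩ := h β
      refine ⟨C, ?_⟩
      rintro _ ⟨ε, hε, ψ, hψ, hψ1, rfl⟩
      refine le_trans (le_of_eq ?_) (hC ε hε ψ hψ hψ1)
      congr 1
      refine integral_congr_ae ?_
      filter_upwards [ae_ballCubeMeasure hn] with z ⟨hz0, _, hzc⟩
      rw [testKernel_update _ _ _ _ _ _ fun x t => β (Real.log ‖x‖) - β (Real.log ‖t • x‖)]
      rw [norm_smul, Real.norm_of_nonneg (hzc j).1.le,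
        Real.log_mul (hzc j).1.ne' (norm_ne_zero_iff.2 hz0)]
      congr 4
      ring)
  exact ⟨C, fun ε hε ψ hψ hψ1 => hC _ ⟨ε, hε, ψ, hψ, hψ1, rfl⟩⟩

/-- Measurable symbols in the central BMO space whose dilation increments grow at most like
`log (2 / t)`. -/
structure IsLogSymbol (q : ℝ) (b : EuclideanSpace ℝ (Fin n) → ℂ) : Prop where
  measurable : Measurable b
  memCentralBMO : MemCentralBMO q b
  bound : ∃ A : ℝ, ∀ x, x ≠ 0 → ∀ t, 0 < t → t < 1 → ‖b x - b (t • x)‖ ≤ A * Real.log (2 / t)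

theorem IsLogSymbol.isLogMultiplier {q : ℝ} {b : E → ℂ} (hb : IsLogSymbol q b) :
    IsLogMultiplier fun x t => b x - b (t • x) := by
  refine ⟨?_, hb.bound⟩
  exact (hb.measurable.comp measurable_fst).sub
    (hb.measurable.comp (measurable_snd.smul measurable_fst))

theorem isLogSymbol_log_norm (hn : 1 ≤ n) {q : ℝ} (hq : 1 ≤ q) :
    IsLogSymbol q (fun x : E => (Real.log ‖x‖ : ℂ)) := by
  refine ⟨by fun_prop, memCentralBMO_log_norm hn hq, 1, fun x hx t ht ht1 => ?_⟩
  have hl2 : 0 < Real.log 2 := Real.log_pos (by norm_num)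
  have hlt : Real.log t < 0 := Real.log_neg ht ht1
  rw [norm_smul, Real.norm_of_nonneg ht.le, Real.log_mul ht.ne' (norm_ne_zero_iff.2 hx),
    ← Complex.ofReal_sub, Complex.norm_real, Real.log_div (by norm_num) ht.ne', Real.norm_eq_abs,
    sub_add_cancel_right, abs_of_pos (by linarith)]
  linarith

theorem isLogSymbol_comp_log_norm {q : ℝ} (hq : 1 ≤ q) (β : ℝ →ᵇ ℂ) :
    IsLogSymbol q (fun x : E => β (Real.log ‖x‖)) := by
  have hm : Measurable (fun x : E => β (Real.log ‖x‖)) :=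
    β.continuous.measurable.comp (by fun_prop)
  refine ⟨hm, memCentralBMO_of_bounded hq hm.aestronglyMeasurable
    fun x => β.norm_coe_le_norm _, ?_⟩
  refine (IsLogMultiplier.of_bounded (A := 2 * ‖β‖)
    (d := fun (x : E) (t : ℝ) => β (Real.log ‖x‖) - β (Real.log ‖t • x‖)) ?_ fun x t => ?_).bound
  · exact (hm.comp measurable_fst).sub (hm.comp (measurable_snd.smul measurable_fst))
  · refine (norm_sub_le _ _).trans ?_
    linarith [β.norm_coe_le_norm (Real.log ‖x‖), β.norm_coe_le_norm (Real.log ‖t • x‖)]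

/-- Combine the multiplier `1` with the symbol `log ‖x‖`, using `log (2 / t) = log 2 + (log ‖x‖ -
log ‖t x‖)`. -/
theorem HasBoundedPairings.update_log_two_div (hn : 1 ≤ n) {ω : (Fin m → ℝ) → ℝ}
    (hω : IntegrableOn ω (openUnitCube m)) {ls : Fin m → ℝ} (hls : ∀ i, ls i < 0)
    {d : Fin m → E → ℝ → ℂ} (hd : ∀ i, IsLogMultiplier (d i)) (j : Fin m) {q : ℝ} (hq : 1 ≤ q)
    (h : ∀ b : E → ℂ, IsLogSymbol q b → HasBoundedPairings ω ls (Function.update d j fun x t =>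
      b x - b (t • x))) :
    HasBoundedPairings ω ls (Function.update d j fun _ t => (Real.log (2 / t) : ℂ)) := by
  obtain ⟨C₁, h₁⟩ := HasBoundedPairings.update_one hn hω hls hd j
    fun β => h _ (isLogSymbol_comp_log_norm hq β)
  obtain ⟨C₂, h₂⟩ := h _ (isLogSymbol_log_norm hn hq)
  have hl2 : 0 < Real.log 2 := Real.log_pos (by norm_num)
  have hd1 := IsLogMultiplier.update hd j
    (IsLogMultiplier.of_bounded (d := fun (_ : E) (_ : ℝ) => (1 : ℂ)) (A := 1)
      measurable_const (by simp))
  have hd2 := IsLogMultiplier.update hd j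
    (isLogSymbol_log_norm (n := n) hn hq).isLogMultiplier
  refine ⟨Real.log 2 * C₁ + C₂, fun ε hε ψ hψ hψ1 => ?_⟩
  have e : ∫ z, testKernel ω ls ε ψ (Function.update d j fun _ t => (Real.log (2 / t) : ℂ)) z
      ∂ballCubeMeasure n m =
      Real.log 2 * ∫ z, testKernel ω ls ε ψ (Function.update d j fun _ _ => 1) z
        ∂ballCubeMeasure n m +
      ∫ z, testKernel ω ls ε ψ (Function.update d j fun x t =>
        (Real.log ‖x‖ : ℂ) - (Real.log ‖t • x‖ : ℂ)) z ∂ballCubeMeasure n m := by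
    rw [← integral_const_mul, ← integral_add
      ((integrable_testKernel hn hω hls hε hψ hψ1 hd1).const_mul _)
      (integrable_testKernel hn hω hls hε hψ hψ1 hd2)]
    refine integral_congr_ae ?_
    filter_upwards [ae_ballCubeMeasure hn] with z ⟨hz0, _, hzc⟩
    rw [testKernel_update _ _ _ _ _ _ fun _ t => (Real.log (2 / t) : ℂ),
      testKernel_update _ _ _ _ _ _ fun x t => (Real.log ‖x‖ : ℂ) - (Real.log ‖t • x‖ : ℂ),
      norm_smul, Real.norm_of_nonneg (hzc j).1.le,
        Real.log_mul (hzc j).1.ne' (norm_ne_zero_iff.2 hz0),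
        Real.log_div (by norm_num) (hzc j).1.ne']
    push_cast
    ring
  rw [e]
  refine (norm_add_le _ _).trans (add_le_add ?_ (h₂ ε hε ψ hψ hψ1))
  rw [norm_mul, Complex.norm_real, Real.norm_of_nonneg hl2.le]
  exact mul_le_mul_of_nonneg_left (h₁ ε hε ψ hψ hψ1) hl2.le

theorem hasBoundedPairings_log_two_div (hn : 1 ≤ n) {ω : (Fin m → ℝ) → ℝ}
    (hω : IntegrableOn ω (openUnitCube m)) {ls : Fin m → ℝ} (hls : ∀ i, ls i < 0)
    {qs : Fin m → ℝ} (hqs : ∀ i, 1 ≤ qs i)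
    (h : ∀ b : Fin m → E → ℂ, (∀ i, IsLogSymbol (qs i) (b i)) →
      HasBoundedPairings ω ls fun i x t => b i x - b i (t • x)) :
    HasBoundedPairings (n := n) ω ls fun _ _ t => (Real.log (2 / t) : ℂ) := by
  classical
  -- The induction must keep all symbols free, since treating coordinate `j` uses the previous case
  -- with every possible symbol in slot `j`.
  have key : ∀ S : Finset (Fin m), ∀ b : Fin m → E → ℂ, (∀ i, IsLogSymbol (qs i) (b i)) →
      HasBoundedPairings ω ls fun i x t =>
        if i ∈ S then (Real.log (2 / t) : ℂ) else b i x - b i (t • x) := by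
    intro S
    induction S using Finset.induction_on with
    | empty => simpa using h
    | insert j S hj ih =>
      intro b hb
      have hd : ∀ i, IsLogMultiplier fun x t =>
          if i ∈ S then (Real.log (2 / t) : ℂ) else b i x - b i (t • x) := by
        intro i
        by_cases hi : i ∈ S
        · simpa [hi] using isLogMultiplier_log_two_div
        · simpa [hi] using (hb i).isLogMultiplier
      have h1 := HasBoundedPairings.update_log_two_div hn hω hls hd j (hqs j) fun b' hb' => by
        have h2 := ih (Function.update b j b') fun i => by
          rcases eq_or_ne i j with rfl | hij
          · rwa [Function.update_self]
          · rw [Function.update_of_ne hij]; exact hb i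
        convert h2 using 1
        ext i x t
        rcases eq_or_ne i j with rfl | hij
        · simp [hj]
        · simp [Function.update_of_ne hij]
      convert h1 using 1
      ext i x t
      rcases eq_or_ne i j with rfl | hij
      · simp
      · simp [hij]
  simpa using key Finset.univ _ fun i => isLogSymbol_log_norm hn (hqs i)

theorem hasBoundedPairings_of_hardyCommutatorBounded (hn : 1 ≤ n) {p l : ℝ} {ps ls : Fin m → ℝ}
    (hp : 1 ≤ p) (hps : ∀ i, 0 < ps i) (hls : ∀ i, -(1 / ps i) < ls i ∧ ls i < 0)
    {ω : (Fin m → ℝ) → ℝ} (hω : IntegrableOn ω (openUnitCube m)) {qs : Fin m → ℝ}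
    {b : Fin m → E → ℂ} (hb : ∀ i, IsLogSymbol (qs i) (b i))
    (h : HardyCommutatorBounded ω b ps ls p l) :
    HasBoundedPairings ω ls fun i x t => b i x - b i (t • x) := by
  have hp0 : 0 < p := by linarith
  obtain ⟨C, hC⟩ := h
  set V := volume (Metric.ball (0 : E) 1)
  have hV0 : V ≠ 0 := volume_ball_pos_ne_zero (n := n) one_pos
  have hVt : V ≠ ∞ := volume_ball_ne_top (n := n) 1
  have : IsFiniteMeasure ((volume : Measure E).restrict (Metric.ball 0 1)) :=
    ⟨by simpa using measure_ball_lt_top⟩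
  -- The first power of `V` comes from the Morrey norm at `R = 1`, the last from Hölder between
  -- `L^1` and `L^p` on the unit ball. The untruncated powers bound the truncated ones, which keeps
  -- `ε` out of `K`.
  set K : ℝ≥0∞ := V ^ (1 / p + l) *
    (C * ∏ i, centralMorreyNorm (ps i) (ls i) (fun x : E => ((‖x‖ ^ (n * ls i) : ℝ) : ℂ))) *
    V ^ (1 - 1 / p) with hK
  have hKt : K ≠ ∞ := by
    refine ENNReal.mul_ne_top (ENNReal.mul_ne_top ?_ (ENNReal.mul_ne_top ENNReal.coe_ne_top
      (ENNReal.prod_ne_top fun i _ =>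
        (centralMorreyNorm_norm_rpow_lt_top hn (hps i) (hls i).1).ne))) ?_ <;>
    simp [ENNReal.rpow_eq_top_iff, hV0, hVt]
  refine ⟨K.toReal, fun ε hε ψ hψ hψ1 => ?_⟩
  set f : Fin m → E → ℂ := fun i => truncPow (n * ls i) ε
  obtain ⟨-, hHm, hHn⟩ := hC f fun i => memCentralMorrey_truncPow hn (hps i) (hls i).1 ε
  have e1 : ∀ z : E × (Fin m → ℝ), testKernel ω ls ε ψ (fun i x t => b i x - b i (t • x)) z =
      ψ z.1 * hardyCommutatorIntegrand ω b f z.1 z.2 := by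
    intro z
    rw [testKernel, hardyCommutatorIntegrand, Finset.prod_mul_distrib]
    ring
  have hint := integrable_testKernel hn hω (fun i => (hls i).2) hε hψ hψ1
    fun i => (hb i).isLogMultiplier
  have e2 : ∫ z, testKernel ω ls ε ψ (fun i x t => b i x - b i (t • x)) z ∂ballCubeMeasure n m =
      ∫ x in Metric.ball 0 1, ψ x * hardyCommutator ω b f x := by
    rw [ballCubeMeasure, integral_prod _ hint]
    simp only [e1, integral_const_mul]
    rfl
  have h1 : ‖∫ x in Metric.ball 0 1, ψ x * hardyCommutator ω b f x‖ₑ ≤ K := by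
    refine (enorm_integral_le_lintegral_enorm _).trans ?_
    have h2 := eLpNorm'_le_eLpNorm'_mul_rpow_measure_univ
      (μ := (volume : Measure E).restrict (Metric.ball 0 1)) (p := 1) (q := p) one_pos hp
      (f := hardyCommutator ω b f) hHm.1.aestronglyMeasurable.restrict
    rw [eLpNorm', Measure.restrict_apply_univ] at h2
    simp only [ENNReal.rpow_one, div_one] at h2
    refine le_trans (lintegral_mono fun x => ?_) (h2.trans ?_)
    · rw [enorm_mul]
      refine mul_le_of_le_one_left (zero_le) ?_
      rw [← ofReal_norm, ENNReal.ofReal_le_one]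
      exact hψ1 x
    · rw [hK]
      gcongr
      refine (eLpNorm'_ball_le_centralMorreyNorm (l := l) hp0 one_pos _).trans ?_
      gcongr
      refine hHn.trans ?_
      gcongr with i
      exact centralMorreyNorm_truncPow_le (hps i) _ _ _
  rw [e2, ← toReal_enorm]
  exact ENNReal.toReal_mono hKt h1

/-- With `ψ = 1` the kernels are nonnegative almost everywhere, so the bounded pairings bound their
`L^1` norms. Fatou's lemma as `ε → 0` gives a finite integral over ball times cube, and this
dominates the constant times the volume of the unit ball. -/
theorem hardyLogConstant_lt_top_of_hasBoundedPairings (hn : 1 ≤ n) {ω : (Fin m → ℝ) → ℝ}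
    (hω_nonneg : ∀ t ∈ Icc (0 : Fin m → ℝ) 1, 0 ≤ ω t)
    (hω : IntegrableOn ω (openUnitCube m)) {ls : Fin m → ℝ} (hls : ∀ i, ls i < 0)
    (h : HasBoundedPairings (n := n) ω ls fun _ _ t => (Real.log (2 / t) : ℂ)) :
    hardyLogConstant n ω ls < ∞ := by
  obtain ⟨C, hC⟩ := h
  set ε : ℕ → ℝ := fun k => 1 / ((k : ℝ) + 1)
  have hε : ∀ k, 0 < ε k := fun k => by positivity
  set G : ℕ → E × (Fin m → ℝ) → ℂ := fun k =>
    testKernel ω ls (ε k) (fun _ => 1) fun _ _ t => (Real.log (2 / t) : ℂ)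
  have hGint : ∀ k, Integrable (G k) (ballCubeMeasure n m) := fun k =>
    integrable_testKernel hn hω hls (hε k) measurable_const (by simp)
      fun _ => isLogMultiplier_log_two_div
  have hGnn : ∀ k, ∀ᵐ z ∂ballCubeMeasure n m, G k z = (‖G k z‖ : ℂ) := by
    intro k
    filter_upwards [ae_ballCubeMeasure hn] with z ⟨hz0, hz1, hzc⟩
    have hfac : ∀ i, ∃ r : ℝ, 0 ≤ r ∧
        truncPow (n * ls i) (ε k) (z.2 i • z.1) * (Real.log (2 / z.2 i) : ℂ) = r := by
      intro i
      have hl := (log_two_div_pos (hzc i).1 (hzc i).2).le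
      rw [truncPow]
      split_ifs
      · exact ⟨‖z.2 i • z.1‖ ^ (n * ls i) * Real.log (2 / z.2 i), by positivity, by push_cast; rfl⟩
      · exact ⟨0, le_rfl, by simp⟩
    choose r hr0 hr using hfac
    have e : G k z = ((∏ i, r i) * ω z.2 : ℝ) := by
      simp only [G, testKernel, hr]
      push_cast
      ring
    rw [e, Complex.norm_real, Real.norm_of_nonneg]
    exact mul_nonneg (Finset.prod_nonneg fun i _ => hr0 i)
      (hω_nonneg _ (openUnitCube_subset_Icc m hzc))
  have hGle : ∀ k, ∫⁻ z, ‖G k z‖ₑ ∂ballCubeMeasure n m ≤ ENNReal.ofReal C := by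
    intro k
    rw [← ofReal_integral_norm_eq_lintegral_enorm (hGint k)]
    refine ENNReal.ofReal_le_ofReal (le_trans (le_of_eq ?_)
      (hC (ε k) (hε k) (fun _ => 1) measurable_const (by simp)))
    change _ = ‖∫ z, G k z ∂ballCubeMeasure n m‖
    rw [integral_congr_ae (hGnn k), integral_complex_ofReal, Complex.norm_real, Real.norm_of_nonneg]
    exact integral_nonneg fun _ => norm_nonneg _
  -- Since `‖x‖ < 1` and `λ_i < 0`, `‖t_i x‖^{nλ_i} ≥ t_i^{nλ_i}`; for fixed `(x, t)` the truncation
  -- is eventually inactive.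
  have hlow : ∀ᵐ z ∂ballCubeMeasure n m, hardyLogWeight n ls z.2 * ‖ω z.2‖ₑ ≤
      liminf (fun k => ‖G k z‖ₑ) atTop := by
    filter_upwards [ae_ballCubeMeasure hn] with z ⟨hz0, hz1, hzc⟩
    refine le_liminf_of_le (by isBoundedDefault) ?_
    have hev : ∀ᶠ k in atTop, ∀ i, ε k < ‖z.2 i • z.1‖ := by
      rw [eventually_all]
      intro i
      have hpos : 0 < ‖z.2 i • z.1‖ := norm_pos_iff.2 (smul_ne_zero (hzc i).1.ne' hz0)
      exact tendsto_one_div_add_atTop_nhds_zero_nat.eventually (gt_mem_nhds hpos)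
    filter_upwards [hev] with k hk
    have hω' : ‖(ω z.2 : ℂ)‖ₑ = ‖ω z.2‖ₑ := by rw [← ofReal_norm, ← ofReal_norm, Complex.norm_real]
    simp only [G, testKernel]
    rw [one_mul, enorm_mul, hω', Complex.enorm_prod, hardyLogWeight]
    refine mul_le_mul_left (Finset.prod_le_prod' fun i _ => ?_) _
    have hl := (log_two_div_pos (hzc i).1 (hzc i).2).le
    have hpos : 0 < ‖z.2 i • z.1‖ := norm_pos_iff.2 (smul_ne_zero (hzc i).1.ne' hz0)
    rw [truncPow, if_pos (hk i), enorm_mul, ← ofReal_norm, ← ofReal_norm, Complex.norm_real,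
      Complex.norm_real, Real.norm_of_nonneg hl, Real.norm_of_nonneg (by positivity)]
    gcongr ENNReal.ofReal ?_ * _
    refine Real.rpow_le_rpow_of_nonpos hpos ?_
      (mul_nonpos_of_nonneg_of_nonpos (by positivity) (hls i).le)
    rw [norm_smul, Real.norm_of_nonneg (hzc i).1.le]
    exact mul_le_of_le_one_right (hzc i).1.le hz1.le
  have hfin : ∫⁻ z, hardyLogWeight n ls z.2 * ‖ω z.2‖ₑ ∂ballCubeMeasure n m ≤ ENNReal.ofReal C :=
    calc _ ≤ ∫⁻ z, liminf (fun k => ‖G k z‖ₑ) atTop ∂ballCubeMeasure n m := lintegral_mono_ae hlow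
      _ ≤ liminf (fun k => ∫⁻ z, ‖G k z‖ₑ ∂ballCubeMeasure n m) atTop :=
        lintegral_liminf_le' fun k => (hGint k).1.enorm
      _ ≤ _ := liminf_le_of_le (by isBoundedDefault) fun c hc => by
        obtain ⟨k, hk⟩ := hc.exists
        exact hk.trans (hGle k)
  rw [ballCubeMeasure, lintegral_prod _ (AEMeasurable.comp_snd
    (f := fun t => hardyLogWeight n ls t * ‖ω t‖ₑ)
    ((measurable_hardyLogWeight ls).aemeasurable.mul hω.aestronglyMeasurable.enorm))] at hfin
  simp only [lintegral_const, Measure.restrict_apply_univ] at hfin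
  rw [hardyLogConstant_eq hω_nonneg]
  by_contra htop
  rw [not_lt, top_le_iff] at htop
  rw [htop, ENNReal.top_mul (volume_ball_pos_ne_zero (n := n) one_pos)] at hfin
  simp at hfin

end Necessity

theorem theorem3p1 (n m : ℕ) (hn : 1 ≤ n) (hm : 1 ≤ m)
    (p l : ℝ) (ps qs ls : Fin m → ℝ)
    (hp : 1 < p) (hps : ∀ i, p < ps i) (hqs : ∀ i, 1 < qs i)
    (hls : ∀ i, -(1 / ps i) < ls i ∧ ls i < 0)
    (hpsum : 1 / p = ∑ i, 1 / ps i + ∑ i, 1 / qs i)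
    (hlsum : l = ∑ i, ls i)
    (ω : (Fin m → ℝ) → ℝ)
    (hω_nonneg : ∀ t ∈ Set.Icc (0 : Fin m → ℝ) 1, 0 ≤ ω t)
    (hω_int : IntegrableOn ω (Set.Icc (0 : Fin m → ℝ) 1)) :
    (hardyLogConstant n ω ls < ∞ →
      ∀ b : Fin m → EuclideanSpace ℝ (Fin n) → ℂ, (∀ i, MemCentralBMO (qs i) (b i)) →
        HardyCommutatorBounded ω b ps ls p l) ∧
    ((∀ i j, ls i * ps i = ls j * ps j) →
      (∀ b : Fin m → EuclideanSpace ℝ (Fin n) → ℂ, (∀ i, MemCentralBMO (qs i) (b i)) →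
        HardyCommutatorBounded ω b ps ls p l) →
      hardyLogConstant n ω ls < ∞) := by
  have hω := hω_int.mono_set (openUnitCube_subset_Icc m)
  refine ⟨fun hK b hb => hardyCommutatorBounded_of_hardyLogConstant_lt_top hω_nonneg
    hω.aestronglyMeasurable hp hps hqs hpsum hlsum hK hb, fun _ h => ?_⟩
  refine hardyLogConstant_lt_top_of_hasBoundedPairings hn hω_nonneg hω (fun i => (hls i).2)
    (hasBoundedPairings_log_two_div hn hω (fun i => (hls i).2) (fun i => (hqs i).le) fun b hb => ?_)
  exact hasBoundedPairings_of_hardyCommutatorBounded hn hp.le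
    (fun i => by linarith [hps i]) hls hω hb (h b fun i => (hb i).memCentralBMO)
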